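/- All matroids are finite. A set $A$ of elements of a matroid $M$ is *cyclic* if the restriction $M|A$ has no coloops; the cyclic flats of $M$ form a lattice $\mathcal{Z}(M)$ under inclusion. The *configuration* of $M$ is the triple $(L,s,\rho)$, unique up to isomorphism, where $L$ is a lattice and $s,\rho:L\to\mathbb{N}$ are functions for which there is a lattice isomorphism $\phi:L\to\mathcal{Z}(M)$ with $s(x)=|\phi(x)|$ and $\rho(x)=r_M(\phi(x))$ for all $x\in L$. Let $M$ be a loopless matroid on $E$ with rank function $r$, and let $m\ge 1$. Choose sets $T_e$ of size $m$, one for each $e\in E$, that are disjoint from $E$ and from each other, and an element $a\notin E\cup\bigcup_{e\in E}T_e$. For $S\subseteq E$ put $q(S)=S\cup\{a\}\cup\bigcup_{e\in S}T_e$. The *free $m$-cone* $Q_m(M)$ is the matroid on $q(E)$ whose cyclic flats are the cyclic flats $Z$ of $M$, with rank $r(Z)$, and the sets $q(F)$ for the nonempty flats $F$ of $M$, with rank $r(F)+1$. **Theorem.** The configuration of the free $m$-cone of a loopless matroid $M$ determines $M$ up to isomorphism: if $M$ and $N$ are loopless matroids, $m,n\ge 1$ are integers, and $Q_m(M)$ and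 $Q_n(N)$ have the same configuration, then $M$ and $N$ are isomorphic. (In particular this holds for $m=n$.) -/

import Mathlib

namespace FreeCone

open Set

/-- A set `A` of elements of `M` is cyclic if the restriction of `M` to `A` has no coloops. -/
def IsCyclic {α : Type*} (M : Matroid α) (A : Set α) : Prop :=
  A ⊆ M.E ∧ ∀ e, ¬ (M.restrict A).IsColoop e

/-- A cyclic flat is a flat that is cyclic. -/
def IsCyclicFlat {α : Type*} (M : Matroid α) (F : Set α) : Prop :=
  M.IsFlat F ∧ IsCyclic M F

/-- The set of cyclic flats of `M`, ordered by inclusion. -/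
abbrev CyclicFlats {α : Type*} (M : Matroid α) : Type _ :=
  {F : Set α // IsCyclicFlat M F}

/-- The triple `(L, s, ρ)` is the configuration of `M`: the abstract lattice `L` is isomorphic to
the lattice of cyclic flats of `M`, and `s` and `ρ` record the size and the rank of the cyclic flat
that corresponds to each element of `L`. -/
def IsConfiguration {α L : Type*} [Lattice L] (M : Matroid α) (s ρ : L → ℕ) : Prop :=
  ∃ φ : L ≃o CyclicFlats M,
    ∀ x : L, (s x : ℕ∞) = (φ x : Set α).encard ∧ (ρ x : ℕ∞) = M.eRk (φ x : Set α)

/-- Two matroids are isomorphic if some bijection between their ground sets preserves independence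
in both directions. -/
def Isomorphic {α β : Type*} (M : Matroid α) (N : Matroid β) : Prop :=
  ∃ φ : M.E ≃ N.E, ∀ I : Set M.E,
    M.Indep (Subtype.val '' I) ↔ N.Indep (Subtype.val '' (φ '' I))

/-- The points from which the ground set of the free `m`-cone is formed: the elements `e` of the
original matroid, the `m` new elements `copy e i` of the set `T_e`, for each `e`, and the tip. -/
inductive Point.{u} (α : Type u) (m : ℕ) : Type u
  | base (e : α) : Point α m
  | copy (e : α) (i : Fin m) : Point α m
  | tip : Point α m

/-- The cone `q(S)` of a set `S`: the elements of `S`, the sets `T_e` with `e ∈ S`, and the tip. -/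
def cone {α : Type*} (m : ℕ) (S : Set α) : Set (Point α m) :=
  {x | match x with
    | .base e => e ∈ S
    | .copy e _ => e ∈ S
    | .tip => True}

/-- The independent sets of the free `m`-cone. The cyclic flats of the free `m`-cone are to be the
cyclic flats `F` of `M`, with their rank in `M`, and the cones of the nonempty flats `F` of `M`,
with rank `r(F) + 1`. A matroid is determined by its cyclic flats and their ranks: a set is
independent exactly when it meets no cyclic flat in more elements than the rank of that flat. -/
def Indep {α : Type*} (m : ℕ) (M : Matroid α) (I : Set (Point α m)) : Prop :=
  I ⊆ cone m M.E ∧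
  (∀ F, IsCyclicFlat M F → (I ∩ Point.base '' F).encard ≤ M.eRk F) ∧
  (∀ F, M.IsFlat F → F.Nonempty → (I ∩ cone m F).encard ≤ M.eRk F + 1)

lemma isCyclic_iff {α : Type*} {M : Matroid α} {A : Set α} :
    IsCyclic M A ↔ A ⊆ M.E ∧ ∀ e ∈ A, e ∈ M.closure (A \ {e}) := by
  unfold IsCyclic
  refine and_congr_right fun hA => ?_
  simp only [Matroid.restrict_isColoop_iff hA]
  grind

lemma isCyclicFlat_closure {α : Type*} {M : Matroid α} {C : Set α} (hC : M.IsCircuit C) :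
    IsCyclicFlat M (M.closure C) := by
  refine ⟨M.isFlat_closure C, isCyclic_iff.2 ⟨M.closure_subset_ground C, fun e he => ?_⟩⟩
  have hcl : e ∈ M.closure (C \ {e}) := by
    rwa [hC.closure_sdiff_singleton_eq e]
  refine M.closure_subset_closure ?_ hcl
  exact sdiff_subset_sdiff_left (M.subset_closure C hC.subset_ground)

lemma exists_augment {β : Type*} {E : Set β} (hE : E.Finite) (f : Set β → ℕ)
    (hmono : ∀ A B, A ⊆ B → B ⊆ E → f A ≤ f B)
    (hsub : ∀ A B, A ⊆ E → B ⊆ E → f (A ∪ B) + f (A ∩ B) ≤ f A + f B)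
    {I J : Set β} (hIE : I ⊆ E) (hJE : J ⊆ E)
    (hI : ∀ A ⊆ I, A.ncard ≤ f A) (hJ : ∀ A ⊆ J, A.ncard ≤ f A)
    (hlt : I.ncard < J.ncard) :
    ∃ e ∈ J, e ∉ I ∧ ∀ A ⊆ insert e I, A.ncard ≤ f A := by
  classical
  by_contra hcon
  push Not at hcon
  have hIfin : I.Finite := hE.subset hIE
  have hJfin : J.Finite := hE.subset hJE
  -- there is a tight subset of `I` that spans each element of `J`
  have key : ∀ K : Set β, K.Finite → K ⊆ J \ I →
      ∃ T ⊆ I, f (T ∪ K) ≤ T.ncard := by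
    intro K hK
    induction K, hK using Set.Finite.induction_on with
    | empty =>
      intro _
      by_cases h0 : f ∅ = 0
      · exact ⟨∅, by simp, by simp [h0]⟩
      · by_cases hne : (J \ I).Nonempty
        · obtain ⟨e, heJ, heI⟩ := hne
          obtain ⟨A, hA, hlt⟩ := hcon e heJ heI
          have hAE : A ⊆ E := hA.trans (insert_subset (hJE heJ) hIE)
          have h1 : (A \ {e}).ncard + 1 ≥ A.ncard := by
            have := Set.ncard_le_ncard_sdiff_add_ncard A {e}
            simpa using this
          refine ⟨A \ {e}, fun x hx => (hA hx.1).resolve_left hx.2, ?_⟩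
          have := hmono (A \ {e} ∪ ∅) A (by simp) hAE
          omega
        · exfalso
          have : J ⊆ I := by
            intro x hx
            by_contra hxI
            exact hne ⟨x, hx, hxI⟩
          have := Set.ncard_le_ncard this hIfin
          omega
    | @insert e K heK hK ih =>
      intro hKJ
      obtain ⟨T, hTI, hT⟩ := ih ((subset_insert e K).trans hKJ)
      have heJ : e ∈ J := (hKJ (by simp)).1
      have heI : e ∉ I := (hKJ (by simp)).2
      obtain ⟨A, hA, hlt⟩ := hcon e heJ heI
      have hAE : A ⊆ E := hA.trans (insert_subset (hJE heJ) hIE)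
      have heA : e ∈ A := by
        by_contra h
        have := hI A fun x hx => (hA hx).resolve_left (fun hxe => h (hxe ▸ hx))
        omega
      have h1 : (A \ {e}).ncard + 1 = A.ncard :=
        Set.ncard_sdiff_singleton_add_one heA (hE.subset hAE)
      have hKE : K ⊆ E := fun x hx => hJE (hKJ (by simp [hx])).1
      have hs := hsub (T ∪ K) A (union_subset (hTI.trans hIE) hKE) hAE
      have hm := hmono (T ∩ (A \ {e})) ((T ∪ K) ∩ A)
        (inter_subset_inter subset_union_left sdiff_subset)
        (inter_subset_right.trans hAE)
      have hi := hI (T ∩ (A \ {e})) (inter_subset_left.trans hTI)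
      have hc := Set.ncard_union_add_ncard_inter T (A \ {e}) (hIfin.subset hTI)
        ((hE.subset hAE).subset sdiff_subset)
      have hm2 := hmono (T ∪ (A \ {e}) ∪ insert e K) (T ∪ K ∪ A) (by
          rintro x ((hx | hx) | (rfl | hx))
          · exact Or.inl (Or.inl hx)
          · exact Or.inr hx.1
          · exact Or.inr heA
          · exact Or.inl (Or.inr hx))
        (union_subset (union_subset (hTI.trans hIE) hKE) hAE)
      have hsubI : T ∪ (A \ {e}) ⊆ I :=
        union_subset hTI fun x hx => (hA hx.1).resolve_left hx.2
      exact ⟨T ∪ (A \ {e}), hsubI, by omega⟩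
  obtain ⟨T, hTI, hT⟩ := key (J \ I) (hJfin.subset sdiff_subset) le_rfl
  have h1 := hJ ((J \ I) ∪ (J ∩ T)) (union_subset sdiff_subset inter_subset_left)
  have h2 := hmono ((J \ I) ∪ (J ∩ T)) (T ∪ (J \ I))
    (union_subset subset_union_right (inter_subset_right.trans subset_union_left))
    (union_subset (hTI.trans hIE) (sdiff_subset.trans hJE))
  have h3 : (J \ I ∪ J ∩ T).ncard = (J \ I).ncard + (J ∩ T).ncard :=
    Set.ncard_union_eq (disjoint_left.2 fun x hx hx' => hx.2 (hTI hx'.2)) (hJfin.subset sdiff_subset) (hJfin.subset inter_subset_left)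
  have h4 := Set.ncard_inter_add_ncard_sdiff_eq_ncard J I hJfin
  have h5 := Set.ncard_le_ncard (s := T ∪ (J ∩ I)) (t := I) (union_subset hTI inter_subset_right) hIfin
  have h6 := Set.ncard_union_add_ncard_inter T (J ∩ I) (hIfin.subset hTI)
    (hJfin.subset inter_subset_left)
  have h7 : T ∩ (J ∩ I) = J ∩ T := by
    ext x; exact ⟨fun h => ⟨h.2.1, h.1⟩, fun h => ⟨h.2, h.1, hTI h.2⟩⟩
  rw [h7] at h6
  omega

variable {α : Type*} {m : ℕ}

/-- The projection `p(A)` of a set of points from the tip to the original matroid. -/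
def proj (A : Set (Point α m)) : Set α :=
  {e | .base e ∈ A ∨ ∃ i, .copy e i ∈ A}

lemma proj_union (A B : Set (Point α m)) : proj (A ∪ B) = proj A ∪ proj B := by
  ext e; simp only [proj, mem_union, mem_ofPred_eq]; grind

lemma proj_mono {A B : Set (Point α m)} (h : A ⊆ B) : proj A ⊆ proj B := by
  intro e; simp only [proj, mem_ofPred_eq]; grind

lemma subset_cone_iff {A : Set (Point α m)} {S : Set α} : A ⊆ cone m S ↔ proj A ⊆ S := by
  constructor
  · rintro h e (he | ⟨i, he⟩)
    · exact h he
    · exact h he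
  · rintro h (e | ⟨e, i⟩ | _) hx
    · exact h (Or.inl hx)
    · exact h (Or.inr ⟨i, hx⟩)
    · trivial

lemma base_injective : Function.Injective (Point.base : α → Point α m) :=
  fun _ _ h => by injection h

lemma cone_finite {S : Set α} (hS : S.Finite) : (cone m S).Finite := by
  have h : cone m S ⊆ (Point.base '' S) ∪ ((fun x : α × Fin m => Point.copy x.1 x.2) ''
      (S ×ˢ univ)) ∪ {Point.tip} := by
    rintro (e | ⟨e, i⟩ | _) hx
    · exact Or.inl (Or.inl ⟨e, hx, rfl⟩)
    · exact Or.inl (Or.inr ⟨(e, i), ⟨hx, trivial⟩, rfl⟩)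
    · exact Or.inr rfl
  exact (((hS.image _).union ((hS.prod finite_univ).image _)).union (finite_singleton _)).subset h

open Classical in
/-- A monotone submodular function whose value at `A` bounds the size of an independent `A`. -/
noncomputable def func (M : Matroid α) (A : Set (Point α m)) : ℕ :=
  (M.eRk (proj A)).toNat + if A ⊆ range Point.base then 0 else 1

lemma coe_toNat_eRk (M : Matroid α) [M.Finite] (S : Set α) :
    ((M.eRk S).toNat : ℕ∞) = M.eRk S :=
  ENat.natCast_toNat (by simp)

lemma toNat_mono (M : Matroid α) [M.Finite] {S T : Set α} (h : S ⊆ T) :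
    (M.eRk S).toNat ≤ (M.eRk T).toNat := by
  rw [← Nat.cast_le (α := ℕ∞), coe_toNat_eRk, coe_toNat_eRk]
  exact M.eRk_mono h

lemma toNat_submod (M : Matroid α) [M.Finite] (S T : Set α) :
    (M.eRk (S ∪ T)).toNat + (M.eRk (S ∩ T)).toNat ≤ (M.eRk S).toNat + (M.eRk T).toNat := by
  rw [← Nat.cast_le (α := ℕ∞)]
  push_cast
  simp only [coe_toNat_eRk]
  rw [add_comm]
  exact M.eRk_inter_add_eRk_union_le S T

lemma func_mono (M : Matroid α) [M.Finite] {A B : Set (Point α m)} (h : A ⊆ B) :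
    func M A ≤ func M B := by
  have := toNat_mono M (proj_mono h)
  unfold func
  split_ifs with h1 h2 h2
  · omega
  · omega
  · exact absurd (h.trans h2) h1
  · omega

lemma func_submod (M : Matroid α) [M.Finite] (A B : Set (Point α m)) :
    func M (A ∪ B) + func M (A ∩ B) ≤ func M A + func M B := by
  have h1 := toNat_submod M (proj A) (proj B)
  have h2 := toNat_mono M (S := proj (A ∩ B)) (T := proj A ∩ proj B)
    (subset_inter (proj_mono inter_subset_left) (proj_mono inter_subset_right))
  have h3 : A ∩ B ⊆ A := inter_subset_left
  have h4 : A ∩ B ⊆ B := inter_subset_right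
  unfold func
  rw [proj_union]
  by_cases hA : A ⊆ range Point.base
  · by_cases hB : B ⊆ range Point.base
    · simp only [hA, hB, union_subset hA hB, h3.trans hA, if_true]; omega
    · simp only [hA, hB, h3.trans hA, if_true, if_false]; split_ifs <;> omega
  · by_cases hB : B ⊆ range Point.base
    · simp only [hA, hB, h4.trans hB, if_true, if_false]; split_ifs <;> omega
    · simp only [hA, hB, if_false]; split_ifs <;> omega

lemma Indep.base_indep {M : Matroid α} [M.Finite] {I : Set (Point α m)} (hI : Indep m M I) :
    M.Indep (Point.base ⁻¹' I) := by
  by_contra hcon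
  have hE : Point.base ⁻¹' I ⊆ M.E := fun e he => hI.1 he
  obtain ⟨C, hCI, hC⟩ := (show M.Dep _ from ⟨hcon, hE⟩).exists_isCircuit_subset
  have h1 := hI.2.1 _ (isCyclicFlat_closure hC)
  rw [Matroid.eRk_closure_eq] at h1
  have h2 : (Point.base (m := m) '' C).encard ≤ (I ∩ Point.base '' M.closure C).encard := by
    refine encard_le_encard (subset_inter (by simpa using hCI) (image_mono ?_))
    exact M.subset_closure C hC.subset_ground
  rw [base_injective.encard_image, ← hC.eRk_add_one_eq] at h2
  have h3 := h2.trans h1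
  rw [← coe_toNat_eRk] at h3
  norm_cast at h3
  omega

lemma indep_iff {M : Matroid α} [M.Finite] {I : Set (Point α m)} :
    Indep m M I ↔ I ⊆ cone m M.E ∧ ∀ A ⊆ I, A.ncard ≤ func M A := by
  constructor
  · intro hI
    refine ⟨hI.1, fun A hA => ?_⟩
    have hAE := hA.trans hI.1
    have hfin : A.Finite := (cone_finite M.ground_finite).subset hAE
    rw [← Nat.cast_le (α := ℕ∞), hfin.cast_ncard_eq]
    unfold func
    split_ifs with h
    · obtain ⟨S, rfl⟩ := subset_range_iff_exists_image_eq.1 h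
      have hp : proj (Point.base (m := m) '' S) = S := by
        ext e; simp [proj]
      have hS : M.Indep S := hI.base_indep.subset (by rwa [← image_subset_iff])
      rw [base_injective.encard_image, hp, add_zero, coe_toNat_eRk, hS.eRk_eq_encard]
    · push_cast
      rw [coe_toNat_eRk]
      by_cases hne : (M.closure (proj A)).Nonempty
      · rw [← Matroid.eRk_closure_eq]
        refine (encard_le_encard (subset_inter hA ?_)).trans (hI.2.2 _ (M.isFlat_closure _) hne)
        rw [subset_cone_iff] at hAE ⊢
        exact M.subset_closure _ hAE
      · have h0 : proj A ⊆ ∅ := by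
          rw [← not_nonempty_iff_eq_empty.1 hne]
          exact M.subset_closure _ (subset_cone_iff.1 hAE)
        have h1 : A ⊆ {Point.tip} := by
          rintro (e | ⟨e, i⟩ | _) hx
          · exact absurd (h0 (Or.inl hx)) (notMem_empty e)
          · exact absurd (h0 (Or.inr ⟨i, hx⟩)) (notMem_empty e)
          · rfl
        refine (encard_le_encard h1).trans ?_
        simp
  · rintro ⟨hE, hI⟩
    have hfin : I.Finite := (cone_finite M.ground_finite).subset hE
    refine ⟨hE, fun F hF => ?_, fun F hF _ => ?_⟩
    · have h := hI (I ∩ Point.base '' F) inter_subset_left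
      rw [← Nat.cast_le (α := ℕ∞), (hfin.subset inter_subset_left).cast_ncard_eq] at h
      refine h.trans ?_
      rw [← coe_toNat_eRk]
      norm_cast
      unfold func
      rw [if_pos (inter_subset_right.trans (image_subset_range _ _)), add_zero]
      refine toNat_mono M ?_
      rintro e (he | ⟨i, he⟩)
      · simpa using he.2
      · simp at he
    · have h := hI (I ∩ cone m F) inter_subset_left
      rw [← Nat.cast_le (α := ℕ∞), (hfin.subset inter_subset_left).cast_ncard_eq] at h
      refine h.trans ?_
      rw [← coe_toNat_eRk]
      norm_cast
      have h2 := toNat_mono M (subset_cone_iff.1 (show I ∩ cone m F ⊆ cone m F from inter_subset_right))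
      unfold func
      split_ifs <;> omega

/-- The free `m`-cone, given by its independent sets. -/
def freeConeIndep (m : ℕ) (M : Matroid α) [M.Finite] : IndepMatroid (Point α m) :=
  IndepMatroid.ofFinite (E := cone m M.E) (cone_finite M.ground_finite) (Indep m M)
    (indep_iff.2 ⟨empty_subset _, fun A hA => by simp [subset_empty_iff.1 hA]⟩)
    (fun I J hJ hIJ => by
      rw [indep_iff] at hJ ⊢
      exact ⟨hIJ.trans hJ.1, fun A hA => hJ.2 A (hA.trans hIJ)⟩)
    (fun I J hI hJ hlt => by
      rw [indep_iff] at hI hJ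
      obtain ⟨e, heJ, heI, h⟩ := exists_augment (cone_finite M.ground_finite) (func M)
        (fun _ _ hAB _ => func_mono M hAB) (fun A B _ _ => func_submod M A B) hI.1 hJ.1 hI.2 hJ.2
        hlt
      exact ⟨e, heJ, heI, indep_iff.2 ⟨insert_subset (hJ.1 heJ) hI.1, h⟩⟩)
    (fun I hI => hI.1)

/-- The free `m`-cone `Q_m(M)` of `M`. Its ground set is the cone of the ground set of `M`; its
cyclic flats and their ranks are found in `freeCone_isCyclicFlat_iff`, `freeCone_eRk_base` and
`freeCone_eRk_cone` below. -/
def freeCone (m : ℕ) (M : Matroid α) [M.Finite] : Matroid (Point α m) :=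
  (freeConeIndep m M).matroid

instance freeCone_finite (M : Matroid α) [M.Finite] : (freeCone m M).Finite :=
  ⟨cone_finite M.ground_finite⟩


lemma isFlat_of_eRk_lt {α : Type*} {M : Matroid α} {X : Set α} (hX : X ⊆ M.E)
    (h : ∀ x ∈ M.E, x ∉ X → M.eRk X < M.eRk (insert x X)) : M.IsFlat X := by
  rw [Matroid.isFlat_iff_closure_eq]
  refine Subset.antisymm (fun x hx => ?_) (M.subset_closure X hX)
  by_contra hxX
  have h1 := h x (M.closure_subset_ground X hx) hxX
  have h2 := M.eRk_mono (insert_subset hx (M.subset_closure X hX))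
  rw [Matroid.eRk_closure_eq] at h2
  exact absurd (h1.trans_le h2) (lt_irrefl _)

lemma eRk_insert_of_isFlat {α : Type*} {M : Matroid α} {X : Set α} (hX : M.IsFlat X) {x : α}
    (hx : x ∈ M.E) (hxX : x ∉ X) : M.eRk (insert x X) = M.eRk X + 1 :=
  Matroid.eRk_insert_eq_add_one ⟨hx, by rwa [hX.closure]⟩

lemma mem_closure_of_eRk_le {α : Type*} {M : Matroid α} [M.Finite] {A B : Set α}
    (hAB : A ⊆ B) (hB : B ⊆ M.E) (h : M.eRk B ≤ M.eRk A) : B ⊆ M.closure A := by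
  rw [(M.isRkFinite_set A).closure_eq_closure_of_subset_of_eRk_ge_eRk hAB h]
  exact M.subset_closure B hB

lemma eRk_le_of_mem_closure {α : Type*} {M : Matroid α} {X : Set α} {x : α}
    (h : x ∈ M.closure (X \ {x})) : M.eRk X ≤ M.eRk (X \ {x}) := by
  have h1 : M.eRk (insert x (X \ {x})) = M.eRk (X \ {x}) := by
    rw [← Matroid.eRk_insert_closure_eq, insert_eq_of_mem h, Matroid.eRk_closure_eq]
  rw [← h1]
  exact M.eRk_mono (by simp)

lemma eRk_lt_add_one (M : Matroid α) [M.Finite] (S : Set α) : M.eRk S < M.eRk S + 1 := by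
  rw [← coe_toNat_eRk]; norm_cast; omega

lemma freeCone_indep_iff {M : Matroid α} [M.Finite] {I : Set (Point α m)} :
    (freeCone m M).Indep I ↔ I ⊆ cone m M.E ∧ M.Indep (Point.base ⁻¹' I) ∧
      ∀ S ⊆ M.E, (I ∩ cone m S).encard ≤ M.eRk S + 1 := by
  change Indep m M I ↔ _
  constructor
  · refine fun hI => ⟨hI.1, hI.base_indep, fun S hS => ?_⟩
    by_cases hne : (M.closure S).Nonempty
    · rw [← Matroid.eRk_closure_eq]
      refine (encard_le_encard (inter_subset_inter_right I ?_)).trans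
        (hI.2.2 _ (M.isFlat_closure S) hne)
      rintro (e | ⟨e, i⟩ | _) hx
      · exact M.subset_closure S hS hx
      · exact M.subset_closure S hS hx
      · trivial
    · have h0 : S ⊆ ∅ := by
        rw [← not_nonempty_iff_eq_empty.1 hne]
        exact M.subset_closure S hS
      have h1 : I ∩ cone m S ⊆ {Point.tip} := by
        rintro (e | ⟨e, i⟩ | _) hx
        · exact absurd (h0 hx.2) (notMem_empty e)
        · exact absurd (h0 hx.2) (notMem_empty e)
        · rfl
      refine (encard_le_encard h1).trans ?_
      simp
  · rintro ⟨hE, hb, hc⟩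
    refine ⟨hE, fun F _ => ?_, fun F hF _ => hc F hF.subset_ground⟩
    have h1 : I ∩ Point.base '' F = Point.base '' (Point.base ⁻¹' I ∩ F) := by
      rw [inter_comm (_ ⁻¹' _), image_inter_preimage, inter_comm]
    rw [h1, base_injective.encard_image]
    exact (hb.subset inter_subset_left).encard_le_eRk_of_subset inter_subset_right

lemma encard_base_inter_cone_le {M : Matroid α} {B : Set α} (hB : M.Indep B) (S : Set α) :
    (Point.base (m := m) '' B ∩ cone m S).encard ≤ M.eRk S := by
  have h : Point.base (m := m) '' B ∩ cone m S ⊆ Point.base '' (B ∩ S) := by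
    rintro _ ⟨⟨e, he, rfl⟩, h⟩
    exact ⟨e, ⟨he, h⟩, rfl⟩
  refine (encard_le_encard h).trans ?_
  rw [base_injective.encard_image]
  exact (hB.subset inter_subset_left).encard_le_eRk_of_subset inter_subset_right

lemma base_image_subset {B S : Set α} (h : B ⊆ S) : Point.base '' B ⊆ cone m S := by
  rintro _ ⟨e, he, rfl⟩; exact h he

lemma indep_insert {M : Matroid α} [M.Finite] {B : Set α} (hB : M.Indep B) {x : Point α m}
    (hx : x ∈ cone m M.E) (hxb : x ∉ range Point.base) :
    (freeCone m M).Indep (insert x (Point.base '' B)) := by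
  rw [freeCone_indep_iff]
  refine ⟨insert_subset hx (base_image_subset hB.subset_ground), ?_, fun S _ => ?_⟩
  · convert hB using 1
    ext e
    simp only [mem_preimage, mem_insert_iff, base_injective.mem_set_image]
    exact or_iff_right fun h => hxb ⟨e, h⟩
  · have h : insert x (Point.base '' B) ∩ cone m S ⊆ insert x (Point.base '' B ∩ cone m S) := by
      rintro y ⟨rfl | hy, hyS⟩
      · exact Or.inl rfl
      · exact Or.inr ⟨hy, hyS⟩
    refine (encard_le_encard h).trans ((encard_insert_le _ _).trans ?_)
    gcongr
    exact encard_base_inter_cone_le hB S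

lemma indep_insert_tip {M : Matroid α} [M.Finite] {B : Set α} {e : α} (hB : M.Indep (insert e B))
    (he : e ∉ B) (i : Fin m) :
    (freeCone m M).Indep (insert Point.tip (insert (Point.copy e i) (Point.base '' B))) := by
  have hBE := hB.subset_ground
  rw [freeCone_indep_iff]
  refine ⟨insert_subset trivial (insert_subset (hBE (mem_insert e B))
    (base_image_subset ((subset_insert e B).trans hBE))), ?_, fun S _ => ?_⟩
  · convert hB.subset (subset_insert e B) using 1
    ext x
    simp
  · have h : insert Point.tip (insert (Point.copy e i) (Point.base '' B)) ∩ cone m S ⊆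
        insert Point.tip (insert (Point.copy e i) (Point.base '' B) ∩ cone m S) := by
      rintro y ⟨rfl | hy, hyS⟩
      · exact Or.inl rfl
      · exact Or.inr ⟨hy, hyS⟩
    refine (encard_le_encard h).trans ((encard_insert_le _ _).trans ?_)
    gcongr
    by_cases heS : e ∈ S
    · have h1 : insert (Point.copy e i) (Point.base '' B) ∩ cone m S ⊆
          insert (Point.copy e i) (Point.base '' (B ∩ S)) := by
        rintro y ⟨rfl | ⟨x, hx, rfl⟩, hyS⟩
        · exact Or.inl rfl
        · exact Or.inr ⟨x, ⟨hx, hyS⟩, rfl⟩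
      refine (encard_le_encard h1).trans ((encard_insert_le _ _).trans ?_)
      rw [base_injective.encard_image, ← encard_insert_of_notMem (fun h => he h.1 : e ∉ B ∩ S)]
      refine (hB.subset ?_).encard_le_eRk_of_subset (insert_subset heS inter_subset_right)
      exact insert_subset_insert inter_subset_left
    · refine (encard_le_encard ?_).trans
        (encard_base_inter_cone_le (m := m) (hB.subset (subset_insert e B)) S)
      rintro y ⟨rfl | hy, hyS⟩
      · exact absurd hyS heS
      · exact ⟨hy, hyS⟩

/-- Subsets of `M` have the same rank in the free `m`-cone as in `M`. -/
theorem freeCone_eRk_base (M : Matroid α) [M.Finite] (S : Set α) :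
    (freeCone m M).eRk (Point.base '' S) = M.eRk S := by
  apply le_antisymm
  · rw [Matroid.eRk_le_iff]
    intro I hIS hI
    obtain ⟨J, hJ, rfl⟩ := subset_image_iff.1 hIS
    have h1 := (freeCone_indep_iff.1 hI).2.1
    rw [preimage_image_eq _ base_injective] at h1
    rw [base_injective.encard_image]
    exact h1.encard_le_eRk_of_subset hJ
  · obtain ⟨B, hBS, hB, hc⟩ := Matroid.le_eRk_iff.1 (le_refl (M.eRk S))
    rw [← hc, ← base_injective.encard_image (β := Point α m)]
    refine Matroid.Indep.encard_le_eRk_of_subset ?_ (image_mono hBS)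
    refine (indep_insert hB (x := Point.tip) trivial (by simp)).subset (subset_insert _ _)

lemma le_eRk_of_indep {M : Matroid α} [M.Finite] {B : Set α} (hB : M.Indep B) {x : Point α m}
    {X : Set (Point α m)} (hx : x ∈ cone m M.E) (hxb : x ∉ range Point.base)
    (hX : insert x (Point.base '' B) ⊆ X) : B.encard + 1 ≤ (freeCone m M).eRk X := by
  have h := (indep_insert hB hx hxb).encard_le_eRk_of_subset hX
  rwa [encard_insert_of_notMem (fun h => hxb (image_subset_range _ _ h)),
    base_injective.encard_image] at h

lemma le_eRk_of_indep_tip {M : Matroid α} [M.Finite] {B : Set α} {e : α}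
    (hB : M.Indep (insert e B)) (he : e ∉ B) (i : Fin m)
    {X : Set (Point α m)}
    (hX : insert Point.tip (insert (Point.copy e i) (Point.base '' B)) ⊆ X) :
    B.encard + 1 + 1 ≤ (freeCone m M).eRk X := by
  have h := (indep_insert_tip hB he i).encard_le_eRk_of_subset hX
  rwa [encard_insert_of_notMem (by simp), encard_insert_of_notMem (by simp),
    base_injective.encard_image] at h

/-- The cone of a set `S` has rank `r(S) + 1` in the free `m`-cone. -/
theorem freeCone_eRk_cone (M : Matroid α) [M.Finite] {S : Set α} (hS : S ⊆ M.E) :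
    (freeCone m M).eRk (cone m S) = M.eRk S + 1 := by
  apply le_antisymm
  · rw [Matroid.eRk_le_iff]
    intro I hIS hI
    have h1 := (freeCone_indep_iff.1 hI).2.2 S hS
    rwa [inter_eq_left.2 hIS] at h1
  · obtain ⟨B, hBS, hB, hc⟩ := Matroid.le_eRk_iff.1 (le_refl (M.eRk S))
    rw [← hc]
    exact le_eRk_of_indep hB (x := Point.tip) trivial (by simp)
      (insert_subset trivial (base_image_subset hBS))

lemma cone_mono {S T : Set α} (h : S ⊆ T) : cone m S ⊆ cone m T := by
  rintro (e | ⟨e, i⟩ | _) hx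
  · exact h hx
  · exact h hx
  · trivial

lemma isFlat_base {M : Matroid α} [M.Finite] {F : Set α} (hF : M.IsFlat F) :
    (freeCone m M).IsFlat (Point.base '' F) := by
  refine isFlat_of_eRk_lt (base_image_subset hF.subset_ground) fun x hx hxF => ?_
  rw [freeCone_eRk_base]
  refine (eRk_lt_add_one M F).trans_le ?_
  by_cases hb : x ∈ range Point.base
  · obtain ⟨e, rfl⟩ := hb
    rw [← image_insert_eq, freeCone_eRk_base]
    exact (eRk_insert_of_isFlat hF hx (fun h => hxF ⟨e, h, rfl⟩)).ge
  · obtain ⟨B, hBS, hB, hc⟩ := Matroid.le_eRk_iff.1 (le_refl (M.eRk F))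
    rw [← hc]
    exact le_eRk_of_indep hB hx hb (insert_subset_insert (image_mono hBS))

lemma isFlat_cone {M : Matroid α} [M.Finite] {F : Set α} (hF : M.IsFlat F) :
    (freeCone m M).IsFlat (cone m F) := by
  refine isFlat_of_eRk_lt (cone_mono hF.subset_ground) fun x hx hxF => ?_
  rw [freeCone_eRk_cone M hF.subset_ground]
  obtain ⟨B, hBF⟩ := M.exists_isBasis F hF.subset_ground
  have key : ∀ e ∈ M.E, e ∉ F → M.Indep (insert e B) ∧ e ∉ B := by
    intro e he heF
    refine ⟨(hBF.indep.insert_indep_iff).2 (Or.inl ⟨he, ?_⟩), fun h => heF (hBF.subset h)⟩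
    rwa [hBF.closure_eq_closure, hF.closure]
  have hlt : M.eRk F + 1 < B.encard + 1 + 1 := by
    rw [hBF.encard_eq_eRk, ← coe_toNat_eRk]; norm_cast; omega
  refine hlt.trans_le ?_
  rcases x with e | ⟨e, i⟩ | _
  · obtain ⟨h1, h2⟩ := key e hx hxF
    rw [← encard_insert_of_notMem h2]
    refine le_eRk_of_indep h1 (x := Point.tip) trivial (by simp) ?_
    rw [image_insert_eq]
    exact insert_subset (Or.inr trivial)
      (insert_subset_insert (base_image_subset hBF.subset))
  · obtain ⟨h1, h2⟩ := key e hx hxF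
    exact le_eRk_of_indep_tip h1 h2 i (insert_subset (Or.inr trivial)
      (insert_subset_insert (base_image_subset hBF.subset)))
  · exact absurd trivial hxF

lemma isCyclic_cone (hm : 1 ≤ m) {M : Matroid α} [M.Finite] {F : Set α} (hF : F ⊆ M.E)
    (hne : F.Nonempty) : IsCyclic (freeCone m M) (cone m F) := by
  refine isCyclic_iff.2 ⟨cone_mono hF, fun x hx => ?_⟩
  refine mem_closure_of_eRk_le sdiff_subset (cone_mono hF) ?_ hx
  obtain ⟨B, hBF⟩ := M.exists_isBasis F hF
  rw [freeCone_eRk_cone M hF, ← hBF.encard_eq_eRk]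
  have hb : Point.base '' B ⊆ cone m F := base_image_subset hBF.subset
  rcases x with e | ⟨e, i⟩ | _
  · by_cases heB : e ∈ B
    · have hB : insert e (B \ {e}) = B := insert_sdiff_self_of_mem heB
      rw [← encard_sdiff_singleton_add_one heB]
      refine le_eRk_of_indep_tip (by rw [hB]; exact hBF.indep) (by simp) ⟨0, hm⟩ ?_
      refine insert_subset ⟨trivial, by simp⟩ (insert_subset ⟨hx, by simp⟩ ?_)
      rintro _ ⟨y, hy, rfl⟩
      exact ⟨hBF.subset hy.1, fun h => hy.2 (base_injective h)⟩
    · refine le_eRk_of_indep hBF.indep (x := Point.tip) trivial (by simp) ?_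
      refine insert_subset ⟨trivial, by simp⟩ ?_
      rintro _ ⟨y, hy, rfl⟩
      exact ⟨hBF.subset hy, fun h => heB (base_injective h ▸ hy)⟩
  · refine le_eRk_of_indep hBF.indep (x := Point.tip) trivial (by simp) ?_
    refine insert_subset ⟨trivial, by simp⟩ (subset_sdiff_singleton hb (by simp))
  · obtain ⟨e, he⟩ := hne
    refine le_eRk_of_indep hBF.indep (x := Point.copy e ⟨0, hm⟩) (hF he) (by simp) ?_
    refine insert_subset ⟨he, by simp⟩ (subset_sdiff_singleton hb (by simp))

lemma base_image_sdiff (F : Set α) (e : α) :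
    Point.base (m := m) '' (F \ {e}) = Point.base '' F \ {Point.base e} := by
  rw [image_sdiff base_injective, image_singleton]

lemma isCyclic_base {M : Matroid α} [M.Finite] {F : Set α} (hF : F ⊆ M.E) :
    IsCyclic (freeCone m M) (Point.base '' F) ↔ IsCyclic M F := by
  have hF' : Point.base '' F ⊆ (freeCone m M).E := base_image_subset hF
  rw [isCyclic_iff, isCyclic_iff, and_iff_right hF, and_iff_right hF', forall_mem_image]
  refine forall₂_congr fun e he => ⟨fun h => ?_, fun h => ?_⟩
  · have h1 := eRk_le_of_mem_closure h
    rw [← base_image_sdiff, freeCone_eRk_base, freeCone_eRk_base] at h1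
    exact mem_closure_of_eRk_le sdiff_subset hF h1 he
  · have h1 := eRk_le_of_mem_closure h
    rw [← freeCone_eRk_base (m := m) M F, ← freeCone_eRk_base (m := m) M, base_image_sdiff] at h1
    exact mem_closure_of_eRk_le sdiff_subset hF' h1 (mem_image_of_mem _ he)

lemma subset_range_of_tip_notMem {M : Matroid α} [M.Finite] {X : Set (Point α m)}
    (hX : IsCyclicFlat (freeCone m M) X) (ht : Point.tip ∉ X) : X ⊆ range Point.base := by
  intro x hx
  by_contra hxb
  have hcl := (isCyclic_iff.1 hX.2).2 x hx
  obtain ⟨C, hCX, hC, hxC⟩ := Matroid.exists_isCircuit_of_mem_closure hcl (by simp)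
  have hCX' : C ⊆ X := hCX.trans (by rw [insert_sdiff_self_of_mem hx])
  have hb : M.Indep (Point.base ⁻¹' C) := by
    have h1 := (freeCone_indep_iff.1 (hC.sdiff_singleton_indep hxC)).2.1
    refine h1.subset fun e he => ⟨he, ?_⟩
    rintro rfl
    exact hxb ⟨e, rfl⟩
  have hdep := hC.not_indep
  rw [freeCone_indep_iff] at hdep
  have hex : ∃ S ⊆ M.E, M.eRk S + 1 < (C ∩ cone m S).encard := by
    by_contra hcon
    push Not at hcon
    exact hdep ⟨hC.subset_ground, hb, hcon⟩
  obtain ⟨S, hS, hlt⟩ := hex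
  have hCS : C ⊆ cone m S := by
    by_contra hcon
    have hss : C ∩ cone m S ⊂ C := ⟨inter_subset_left, fun h => hcon fun y hy => (h hy).2⟩
    have h1 := (freeCone_indep_iff.1 (hC.ssubset_indep hss)).2.2 S hS
    rw [inter_assoc, inter_self] at h1
    exact absurd (hlt.trans_le h1) (lt_irrefl _)
  rw [inter_eq_left.2 hCS, ← encard_sdiff_singleton_add_one hxC,
    ← (hC.sdiff_singleton_indep hxC).eRk_eq_encard, ← freeCone_eRk_cone M hS] at hlt
  have h2 : cone m S ⊆ (freeCone m M).closure (C \ {x}) :=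
    mem_closure_of_eRk_le (sdiff_subset.trans hCS) (cone_mono hS) (Order.le_of_lt_add_one hlt)
  have h3 : (freeCone m M).closure (C \ {x}) ⊆ X := by
    rw [← hX.1.closure]
    exact (freeCone m M).closure_subset_closure (sdiff_subset.trans hCX')
  exact ht (h3 (h2 trivial))

lemma eq_cone_of_tip_mem {M : Matroid α} [M.Finite] [M.Loopless] {X : Set (Point α m)}
    (hX : (freeCone m M).IsFlat X) (ht : Point.tip ∈ X) : X = cone m (proj X) := by
  have key : ∀ x ∈ X, ∀ e ∈ M.E, (freeCone m M).Indep {Point.tip, x} → x ∈ cone m {e} →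
      x ≠ Point.tip → cone m {e} ⊆ X := by
    intro x hx e he hind hxe hxt
    have h1 : cone m {e} ⊆ (freeCone m M).closure {Point.tip, x} := by
      refine mem_closure_of_eRk_le (insert_subset trivial (by simpa using hxe))
        (cone_mono (by simpa using he)) ?_
      rw [hind.eRk_eq_encard, freeCone_eRk_cone M (by simpa using he),
        encard_insert_of_notMem (by simpa using hxt.symm), encard_singleton]
      gcongr
      exact M.eRk_singleton_le e
    refine h1.trans ?_
    rw [← hX.closure]
    exact (freeCone m M).closure_subset_closure (insert_subset ht (by simpa using hx))
  have key2 : ∀ e ∈ proj X, cone m {e} ⊆ X := by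
    rintro e (he | ⟨i, he⟩)
    · have heE : e ∈ M.E := hX.subset_ground he
      refine key _ he e heE ?_ rfl (by simp)
      have := indep_insert (m := m) (B := {e}) (M := M)
        (Matroid.indep_singleton.2 (Matroid.isNonloop_of_loopless heE))
        (x := Point.tip) trivial (by simp)
      simpa using this
    · have heE : e ∈ M.E := hX.subset_ground he
      refine key _ he e heE ?_ rfl (by simp)
      have := indep_insert_tip (m := m) (B := ∅) (M := M) (e := e)
        (by simpa using Matroid.isNonloop_of_loopless heE) (by simp) i
      simpa using this
  refine Subset.antisymm (subset_cone_iff.2 subset_rfl) ?_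
  rintro (e | ⟨e, i⟩ | _) hx
  · exact key2 e hx rfl
  · exact key2 e hx rfl
  · exact ht

/-- The cyclic flats of the free `m`-cone of a loopless matroid `M` are the cyclic flats of `M` and
the cones of the nonempty flats of `M`. -/
theorem freeCone_isCyclicFlat_iff (hm : 1 ≤ m) (M : Matroid α) [M.Finite] [M.Loopless]
    (X : Set (Point α m)) :
    IsCyclicFlat (freeCone m M) X ↔
      (∃ F, IsCyclicFlat M F ∧ X = Point.base '' F) ∨
      (∃ F, M.IsFlat F ∧ F.Nonempty ∧ X = cone m F) := by
  constructor
  · intro hX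
    by_cases ht : Point.tip ∈ X
    · right
      have h := eq_cone_of_tip_mem hX.1 ht
      have hpE : proj X ⊆ M.E := subset_cone_iff.1 hX.1.subset_ground
      refine ⟨proj X, isFlat_of_eRk_lt hpE fun e he heX => ?_, ?_, h⟩
      · have h1 := eRk_insert_of_isFlat hX.1 (x := Point.base e) he (fun h => heX (Or.inl h))
        have h2 := (freeCone m M).eRk_mono (show insert (Point.base e) X ⊆
          cone m (insert e (proj X)) from insert_subset (Or.inl rfl)
            (subset_cone_iff.2 (subset_insert _ _)))
        have h3 := freeCone_eRk_cone (m := m) M hpE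
        rw [← h] at h3
        rw [h1, freeCone_eRk_cone M (insert_subset he hpE), h3] at h2
        refine (eRk_lt_add_one M _).trans_le ?_
        exact (ENat.add_le_add_iff_right (by simp)).1 h2
      · by_contra hne
        rw [not_nonempty_iff_eq_empty] at hne
        have h1 : X \ {Point.tip} ⊆ ∅ := by
          rintro (e | ⟨e, i⟩ | _) hx
          · exact (hne ▸ Or.inl hx.1 : e ∈ (∅ : Set α))
          · exact (hne ▸ Or.inr ⟨i, hx.1⟩ : e ∈ (∅ : Set α))
          · exact hx.2 rfl
        have h2 := (isCyclic_iff.1 hX.2).2 _ ht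
        rw [subset_empty_iff.1 h1] at h2
        have h3 := indep_insert (m := m) (M := M) M.empty_indep (x := Point.tip) trivial (by simp)
        have h4 := h3.notMem_closure_sdiff_of_mem (mem_insert _ _)
        exact h4 ((freeCone m M).closure_subset_closure (empty_subset _) h2)
    · left
      obtain ⟨F, rfl⟩ := subset_range_iff_exists_image_eq.1 (subset_range_of_tip_notMem hX ht)
      have hF : F ⊆ M.E := fun e he => hX.1.subset_ground (mem_image_of_mem _ he)
      refine ⟨F, ⟨isFlat_of_eRk_lt hF fun e he heF => ?_, (isCyclic_base hF).1 hX.2⟩, rfl⟩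
      have h1 := eRk_insert_of_isFlat hX.1 (x := Point.base e) he
        (by simpa using heF)
      rw [← image_insert_eq, freeCone_eRk_base, freeCone_eRk_base] at h1
      rw [h1]
      exact eRk_lt_add_one M F
  · rintro (⟨F, hF, rfl⟩ | ⟨F, hF, hne, rfl⟩)
    · exact ⟨isFlat_base hF.1, (isCyclic_base hF.1.subset_ground).2 hF.2⟩
    · exact ⟨isFlat_cone hF, isCyclic_cone hm hF.subset_ground hne⟩

lemma isCyclicFlat_closure_sUnion (M : Matroid α) (S : Set (CyclicFlats M)) :
    IsCyclicFlat M (M.closure (⋃ F ∈ S, F.1)) := by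
  refine ⟨M.isFlat_closure _, isCyclic_iff.2 ⟨M.closure_subset_ground _, fun e he => ?_⟩⟩
  have hU : (⋃ F ∈ S, F.1) ⊆ M.closure (⋃ F ∈ S, F.1) :=
    M.subset_closure _ (iUnion₂_subset fun F _ => F.2.1.subset_ground)
  by_cases h : e ∈ ⋃ F ∈ S, F.1
  · obtain ⟨F, hF, heF⟩ := mem_iUnion₂.1 h
    refine M.closure_subset_closure ?_ ((isCyclic_iff.1 F.2.2).2 e heF)
    exact sdiff_subset_sdiff_left ((subset_biUnion_of_mem (u := fun F => F.1) hF).trans hU)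
  · exact M.closure_subset_closure (subset_sdiff_singleton hU h) he

/-- The cyclic flats of a matroid form a lattice under inclusion. -/
@[reducible] noncomputable def cyclicFlatsLattice (M : Matroid α) : Lattice (CyclicFlats M) :=
  letI : SupSet (CyclicFlats M) := ⟨fun S => ⟨_, isCyclicFlat_closure_sUnion M S⟩⟩
  (completeLatticeOfSup (CyclicFlats M) fun S => by
    refine ⟨fun F hF => ?_, fun G hG => ?_⟩
    · exact (subset_biUnion_of_mem (u := fun F : CyclicFlats M => F.1) hF).trans
        (M.subset_closure _ (iUnion₂_subset fun F _ => F.2.1.subset_ground))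
    · change M.closure _ ⊆ G.1
      rw [← G.2.1.closure]
      exact M.closure_subset_closure (iUnion₂_subset fun F hF => hG hF)).toLattice

/-- Every finite matroid has a configuration. -/
theorem exists_isConfiguration (M : Matroid α) [M.Finite] :
    ∃ (_ : Lattice (CyclicFlats M)) (s ρ : CyclicFlats M → ℕ), IsConfiguration M s ρ := by
  refine ⟨cyclicFlatsLattice M, fun F => F.1.ncard, fun F => (M.eRk F.1).toNat,
    OrderIso.refl _, fun F => ⟨?_, coe_toNat_eRk M _⟩⟩
  exact (M.ground_finite.subset F.2.1.subset_ground).cast_ncard_eq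

end FreeCone

/-!
The lattice of cyclic flats of `Q_m(M)` contains the poset of nonempty flats of `M`, as the cones.
A loopless matroid is determined by that poset together with the sizes of its minimal elements, the
parallel classes (`isomorphic_of_nonemptyFlats`). The size of a parallel class `P` is found in the
configuration: if `P` is nontrivial, then it is the only nonempty cyclic flat strictly below its
cone, and otherwise there is none (`isomorphic_of_map_cones`). Neither `m` nor `n` is needed for
this. So it is enough to tell the cones from the cyclic flats of `M` inside the configuration.

For a cyclic flat `x` of a matroid `Q`, the sets `y \ x`, with `y` a cyclic flat above `x` of rank
`r(x) + 1`, are disjoint, so the size of their union is a function of the configuration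
(`ncard_coverUnion_eq`). In the free cone, that union is all of the complement of `x` when `x` is a
cone, since the flats that cover a cone are cones (`coverUnion_coneFlat`). When `x` is a cyclic flat
of `M` that misses an element `e` of `M`, the union misses the copies of `e`. Hence a bijection that
preserves the configuration sends cones to cones, except that it may exchange roles between a cone
and the ground set of the matroid, when that is cyclic (`map_eq_base_ground`).

If this exception occurs, then the matroids have rank two, the cone in question is that of a
parallel class, and it has the same elements above and below it as the ground set of `M`. Composing
with the automorphism that exchanges these two elements gives an isomorphism of the lattices that
sends cones to cones and still preserves the sizes of the cyclic flats of rank one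
(`isomorphic_of_map_cone_eq_base`).
-/

namespace FreeCone

open Set

/-! ### Flats of loopless matroids -/

lemma eq_of_isFlat_of_eRk_le {α : Type*} {M : Matroid α} [M.Finite] {F G : Set α}
    (hF : M.IsFlat F) (hG : G ⊆ M.E) (hFG : F ⊆ G) (h : M.eRk G ≤ M.eRk F) : F = G := by
  refine hFG.antisymm ?_
  rw [← hF.closure]
  exact mem_closure_of_eRk_le hFG hG h

/-- The nonempty flats of `M`, ordered by inclusion. -/
abbrev NonemptyFlats {α : Type*} (M : Matroid α) : Type _ :=
  {F : Set α // M.IsFlat F ∧ F.Nonempty}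

/-- The closure of an element: in a loopless matroid, its parallel class. -/
def parallelClass {α : Type*} (M : Matroid α) (e : M.E) : NonemptyFlats M :=
  ⟨M.closure {e.1}, M.isFlat_closure _, e.1, M.mem_closure_self e.1 e.2⟩

lemma parallelClass_le_iff {α : Type*} {M : Matroid α} {e : M.E} {F : NonemptyFlats M} :
    parallelClass M e ≤ F ↔ e.1 ∈ F.1 := by
  refine ⟨fun h => h (M.mem_closure_self e.1 e.2), fun h => ?_⟩
  change M.closure {e.1} ⊆ F.1
  rw [← F.2.1.closure]
  exact M.closure_subset_closure (by simpa using h)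

lemma parallelClass_eq_of_mem {α : Type*} {M : Matroid α} [M.Loopless] {e f : M.E}
    (h : f.1 ∈ (parallelClass M e).1) : parallelClass M f = parallelClass M e :=
  Subtype.ext ((Matroid.isNonloop_of_loopless f.2).closure_eq_of_mem_closure h)

lemma isMin_parallelClass {α : Type*} {M : Matroid α} [M.Loopless] (e : M.E) :
    IsMin (parallelClass M e) := by
  intro F hF
  obtain ⟨f, hf⟩ := F.2.2
  rw [← parallelClass_eq_of_mem (f := ⟨f, F.2.1.subset_ground hf⟩) (hF hf)]
  exact parallelClass_le_iff.2 hf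

lemma parallelClass_eq_iff {α : Type*} {M : Matroid α} {F : NonemptyFlats M}
    (hF : IsMin F) {e : M.E} : parallelClass M e = F ↔ e.1 ∈ F.1 := by
  rw [← parallelClass_le_iff]
  exact ⟨le_of_eq, fun h => h.antisymm (hF h)⟩

lemma eRk_parallelClass {α : Type*} {M : Matroid α} [M.Loopless] (e : M.E) :
    M.eRk (parallelClass M e).1 = 1 := by
  change M.eRk (M.closure {e.1}) = 1
  rw [Matroid.eRk_closure_eq]
  exact (Matroid.isNonloop_of_loopless e.2).eRk_eq

/-- A nontrivial parallel class is cyclic. -/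
lemma isCyclicFlat_parallelClass {α : Type*} {M : Matroid α} [M.Loopless] {e : M.E}
    (h : (parallelClass M e).1.Nontrivial) : IsCyclicFlat M (parallelClass M e).1 := by
  refine ⟨(parallelClass M e).2.1, isCyclic_iff.2 ⟨M.closure_subset_ground _, fun g hg => ?_⟩⟩
  obtain ⟨f, hf, hfg⟩ := h.exists_ne g
  have hfE := (parallelClass M e).2.1.subset_ground hf
  have h1 := parallelClass_eq_of_mem (e := e) (f := ⟨f, hfE⟩) hf
  rw [← h1] at hg
  exact M.closure_subset_closure (by simpa using ⟨hf, hfg⟩) hg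

lemma nontrivial_of_isCyclic {α : Type*} {M : Matroid α} [M.Loopless] {A : Set α}
    (h : IsCyclic M A) (hne : A.Nonempty) : A.Nontrivial := by
  by_contra hA
  rw [Set.not_nontrivial_iff] at hA
  obtain ⟨e, he⟩ := hne
  obtain rfl : A = {e} := hA.eq_singleton_of_mem he
  have h1 := (isCyclic_iff.1 h).2 e he
  rw [sdiff_self] at h1
  exact (Matroid.isNonloop_of_loopless (h.1 he)).not_isLoop h1

/-- A rank-two matroid with three parallel classes has no coloops. -/
lemma isCyclicFlat_ground_of_three {α : Type*} {M : Matroid α} [M.Finite] [M.Loopless]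
    (hr : M.eRk M.E = 2) {a b c : M.E} (hab : parallelClass M a ≠ parallelClass M b)
    (hac : parallelClass M a ≠ parallelClass M c) (hbc : parallelClass M b ≠ parallelClass M c) :
    IsCyclicFlat M M.E := by
  refine ⟨M.ground_isFlat, isCyclic_iff.2 ⟨subset_rfl, fun e he => ?_⟩⟩
  have key : ∀ p q : M.E, parallelClass M p ≠ parallelClass M q → p.1 ≠ e → q.1 ≠ e →
      e ∈ M.closure (M.E \ {e}) := by
    intro p q hpq hp hq
    have hpE := p.2
    have hqE := q.2
    have h1 : q.1 ∉ (parallelClass M p).1 := fun h => hpq (parallelClass_eq_of_mem h).symm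
    have h2 : M.Indep {q.1, p.1} := by
      rw [Matroid.Indep.insert_indep_iff
        (Matroid.indep_singleton.2 (Matroid.isNonloop_of_loopless hpE))]
      exact Or.inl ⟨hqE, h1⟩
    have hne : q.1 ≠ p.1 := fun h => hpq (by rw [Subtype.ext h])
    have h3 : M.E ⊆ M.closure {q.1, p.1} := by
      refine mem_closure_of_eRk_le h2.subset_ground subset_rfl ?_
      rw [hr, h2.eRk_eq_encard, encard_pair hne]
    refine M.closure_subset_closure ?_ (h3 he)
    rintro x (rfl | rfl)
    · exact ⟨hqE, hq⟩
    · exact ⟨hpE, hp⟩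
  by_cases ha : a.1 = e
  · have hb : b.1 ≠ e := fun h => hab (by rw [Subtype.ext (ha.trans h.symm)])
    have hc : c.1 ≠ e := fun h => hac (by rw [Subtype.ext (ha.trans h.symm)])
    exact key b c hbc hb hc
  · by_cases hb : b.1 = e
    · have hc : c.1 ≠ e := fun h => hbc (by rw [Subtype.ext (hb.trans h.symm)])
      exact key a c hac ha hc
    · exact key a b hab ha hb

/-! ### A loopless matroid is determined by its nonempty flats -/

lemma exists_equiv_of_fibers {A B X Y : Type*} (f : A → X) (g : B → Y) (θ : X ≃ Y)
    (h : ∀ x, Nonempty ({a // f a = x} ≃ {b // g b = θ x})) :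
    ∃ φ : A ≃ B, ∀ a, g (φ a) = θ (f a) := by
  let κ := fun x => (h x).some
  refine ⟨(Equiv.sigmaFiberEquiv f).symm.trans ((Equiv.sigmaCongr θ κ).trans
    (Equiv.sigmaFiberEquiv g)), fun a => ?_⟩
  exact (κ (f a) ⟨a, rfl⟩).2

lemma indep_image_of_isFlat_image {α β : Type*} {M : Matroid α} {N : Matroid β} (φ : M.E ≃ N.E)
    (h : ∀ F, M.IsFlat F → N.IsFlat (Subtype.val '' (φ '' (Subtype.val ⁻¹' F)))) {I : Set M.E}
    (hI : M.Indep (Subtype.val '' I)) : N.Indep (Subtype.val '' (φ '' I)) := by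
  have hsub : ∀ J : Set N.E, Subtype.val '' J ⊆ N.E := by rintro J _ ⟨x, -, rfl⟩; exact x.2
  rw [Matroid.indep_iff_forall_notMem_closure_sdiff (hsub _)]
  rw [Matroid.indep_iff_forall_notMem_closure_sdiff hI.subset_ground] at hI
  rintro _ ⟨_, ⟨e, he, rfl⟩, rfl⟩ hcl
  refine hI (mem_image_of_mem _ he) ?_
  rw [Matroid.mem_closure_iff_forall_mem_isFlat _ (sdiff_subset.trans (hsub _))] at hcl
  obtain ⟨_, ⟨x, hx, rfl⟩, hxe⟩ := hcl _ (h _ (M.isFlat_closure (Subtype.val '' I \ {e.1}))) (by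
    rintro _ ⟨⟨_, ⟨f, hf, rfl⟩, rfl⟩, hfe⟩
    refine ⟨_, ⟨f, ?_, rfl⟩, rfl⟩
    refine M.subset_closure _ ?_ ⟨⟨f, hf, rfl⟩, ?_⟩
    · rintro _ ⟨⟨y, -, rfl⟩, -⟩
      exact y.2
    · rintro hfe'
      exact hfe (by rw [Subtype.ext hfe']; rfl))
  rw [φ.injective (Subtype.ext hxe)] at hx
  exact hx

lemma Isomorphic.symm {α β : Type*} {M : Matroid α} {N : Matroid β} (h : Isomorphic M N) :
    Isomorphic N M := by
  obtain ⟨φ, hφ⟩ := h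
  refine ⟨φ.symm, fun I => ?_⟩
  rw [hφ, ← image_comp φ, Equiv.self_comp_symm, image_id]

lemma isFlat_empty {α : Type*} (M : Matroid α) [M.Loopless] : M.IsFlat ∅ := by
  rw [Matroid.isFlat_iff_closure_eq]
  exact M.loops_eq_empty

lemma isFlat_image_of_mem_iff {α β : Type*} {M : Matroid α} {N : Matroid β} [N.Loopless]
    (φ : M.E ≃ N.E) (θ : NonemptyFlats M → NonemptyFlats N)
    (h : ∀ (e : M.E) (F : NonemptyFlats M), e.1 ∈ F.1 ↔ (φ e).1 ∈ (θ F).1) (F : Set α)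
    (hF : M.IsFlat F) : N.IsFlat (Subtype.val '' (φ '' (Subtype.val ⁻¹' F))) := by
  rcases F.eq_empty_or_nonempty with rfl | hne
  · simpa using isFlat_empty N
  · convert (θ ⟨F, hF, hne⟩).2.1 using 1
    ext y
    constructor
    · rintro ⟨_, ⟨e, he, rfl⟩, rfl⟩
      exact (h e ⟨F, hF, hne⟩).1 he
    · intro hy
      have hyE := (θ ⟨F, hF, hne⟩).2.1.subset_ground hy
      refine ⟨⟨y, hyE⟩, ⟨φ.symm ⟨y, hyE⟩, ?_, by simp⟩, rfl⟩
      exact (h _ ⟨F, hF, hne⟩).2 (by simpa using hy)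

/-- An isomorphism between the posets of nonempty flats that preserves the sizes of the parallel
classes comes from a matroid isomorphism: glue bijections between the parallel classes. -/
lemma isomorphic_of_nonemptyFlats {α β : Type*} {M : Matroid α} {N : Matroid β}
    [M.Finite] [N.Finite] [M.Loopless] [N.Loopless] (θ : NonemptyFlats M ≃o NonemptyFlats N)
    (hθ : ∀ e : M.E, (θ (parallelClass M e)).1.encard = (parallelClass M e).1.encard) :
    Isomorphic M N := by
  have hfib : ∀ F : NonemptyFlats M, Nonempty
      ({e // parallelClass M e = F} ≃ {e // parallelClass N e = θ.toEquiv F}) := by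
    intro F
    by_cases hF : IsMin F
    · have hF' : IsMin (θ F) := θ.isMin_apply.2 hF
      obtain ⟨e, he⟩ := F.2.2
      have hcard := hθ ⟨e, F.2.1.subset_ground he⟩
      rw [(parallelClass_eq_iff hF).2 he] at hcard
      have hfin := M.ground_finite.subset F.2.1.subset_ground
      have hfin' := N.ground_finite.subset (θ F).2.1.subset_ground
      have hn : Nonempty (F.1 ≃ (θ F).1) := by
        have := hfin.to_subtype
        have := hfin'.to_subtype
        refine Finite.card_eq.1 ?_
        change F.1.ncard = (θ F).1.ncard
        rw [Set.ncard, Set.ncard, hcard]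
      obtain ⟨κ⟩ := hn
      refine ⟨Equiv.trans ?_ (κ.trans ?_)⟩
      · exact
          { toFun := fun e => ⟨e.1.1, (parallelClass_eq_iff hF).1 e.2⟩
            invFun := fun e => ⟨⟨e.1, F.2.1.subset_ground e.2⟩, (parallelClass_eq_iff hF).2 e.2⟩
            left_inv := fun _ => rfl
            right_inv := fun _ => rfl }
      · exact
          { toFun := fun e => ⟨⟨e.1, (θ F).2.1.subset_ground e.2⟩,
              (parallelClass_eq_iff hF').2 e.2⟩
            invFun := fun e => ⟨e.1.1, (parallelClass_eq_iff hF').1 e.2⟩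
            left_inv := fun _ => rfl
            right_inv := fun _ => rfl }
    · have h1 : IsEmpty {e // parallelClass M e = F} :=
        ⟨fun e => hF (e.2 ▸ isMin_parallelClass e.1)⟩
      have h2 : IsEmpty {e // parallelClass N e = θ.toEquiv F} :=
        ⟨fun e => hF (θ.isMin_apply.1 (e.2 ▸ isMin_parallelClass e.1))⟩
      exact ⟨Equiv.equivOfIsEmpty _ _⟩
  obtain ⟨φ, hφ⟩ := exists_equiv_of_fibers (parallelClass M) (parallelClass N) θ.toEquiv hfib
  have hmem : ∀ (e : M.E) (F : NonemptyFlats M), e.1 ∈ F.1 ↔ (φ e).1 ∈ (θ F).1 := by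
    intro e F
    rw [← parallelClass_le_iff, ← parallelClass_le_iff, hφ]
    exact θ.le_iff_le.symm
  have hmem' : ∀ (e : N.E) (F : NonemptyFlats N), e.1 ∈ F.1 ↔ (φ.symm e).1 ∈ (θ.symm F).1 := by
    intro e F
    simpa using (hmem (φ.symm e) (θ.symm F)).symm
  refine ⟨φ, fun I => ⟨indep_image_of_isFlat_image φ (isFlat_image_of_mem_iff φ θ hmem),
    fun hI => ?_⟩⟩
  have h := indep_image_of_isFlat_image φ.symm (isFlat_image_of_mem_iff φ.symm θ.symm hmem') hI
  rwa [← image_comp φ.symm, Equiv.symm_comp_self, image_id] at h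

/-! ### Counting the elements of the cyclic flats that cover a given one -/

/-- The elements outside `x` of the cyclic flats that contain `x` and whose rank is one more than
that of `x`. -/
def coverUnion {α : Type*} (Q : Matroid α) (x : CyclicFlats Q) : Set α :=
  ⋃ y : {y : CyclicFlats Q // x ≤ y ∧ Q.eRk y.1 = Q.eRk x.1 + 1}, y.1.1 \ x.1

lemma mem_coverUnion {α : Type*} {Q : Matroid α} {x : CyclicFlats Q} {p : α} :
    p ∈ coverUnion Q x ↔
      ∃ y : CyclicFlats Q, x ≤ y ∧ Q.eRk y.1 = Q.eRk x.1 + 1 ∧ p ∈ y.1 ∧ p ∉ x.1 := by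
  simp only [coverUnion, mem_iUnion, Subtype.exists, mem_sdiff]
  grind

lemma coverUnion_subset {α : Type*} (Q : Matroid α) (x : CyclicFlats Q) :
    coverUnion Q x ⊆ Q.E \ x.1 := by
  intro p hp
  obtain ⟨y, -, -, hy, hx⟩ := mem_coverUnion.1 hp
  exact ⟨y.2.1.subset_ground hy, hx⟩

/-- Flats that cover the same flat have no other elements in common, as such a flat is spanned by
the covered flat and any one further element. -/
lemma pairwise_disjoint_covers {α : Type*} (Q : Matroid α) [Q.Finite] (x : CyclicFlats Q) :
    Pairwise (Function.onFun Disjoint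
      fun y : {y : CyclicFlats Q // x ≤ y ∧ Q.eRk y.1 = Q.eRk x.1 + 1} => y.1.1 \ x.1) := by
  intro y z hyz
  refine disjoint_left.2 fun p hpy hpz => hyz ?_
  have key : ∀ w : {y : CyclicFlats Q // x ≤ y ∧ Q.eRk y.1 = Q.eRk x.1 + 1}, p ∈ w.1.1 \ x.1 →
      Q.closure (insert p x.1) = w.1.1 := by
    intro w hw
    have hpE := w.1.2.1.subset_ground hw.1
    have hsub : insert p x.1 ⊆ w.1.1 := insert_subset hw.1 w.2.1
    refine eq_of_isFlat_of_eRk_le (Q.isFlat_closure _) w.1.2.1.subset_ground ?_ ?_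
    · rw [← w.1.2.1.closure]
      exact Q.closure_subset_closure hsub
    · rw [Q.eRk_closure_eq, eRk_insert_of_isFlat x.2.1 hpE hw.2, w.2.2]
  exact Subtype.ext (Subtype.ext ((key y hpy).symm.trans (key z hpz)))

/-- The number of elements of `coverUnion` depends only on the configuration. -/
lemma ncard_coverUnion_eq {α β : Type*} {Q : Matroid α} {R : Matroid β} [Q.Finite] [R.Finite]
    (ψ : CyclicFlats Q ≃o CyclicFlats R) (hs : ∀ x, (ψ x).1.encard = x.1.encard)
    (hr : ∀ x, R.eRk (ψ x).1 = Q.eRk x.1) (x : CyclicFlats Q) :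
    (coverUnion R (ψ x)).ncard = (coverUnion Q x).ncard := by
  have hfQ : ∀ y : CyclicFlats Q, y.1.Finite := fun y =>
    Q.ground_finite.subset y.2.1.subset_ground
  have hfR : ∀ y : CyclicFlats R, y.1.Finite := fun y =>
    R.ground_finite.subset y.2.1.subset_ground
  let κ : {y : CyclicFlats Q // x ≤ y ∧ Q.eRk y.1 = Q.eRk x.1 + 1} ≃
      {y : CyclicFlats R // ψ x ≤ y ∧ R.eRk y.1 = R.eRk (ψ x).1 + 1} :=
    ψ.toEquiv.subtypeEquiv fun y => by simp [hr]
  have hκ : ∀ y, Nonempty (↥(y.1.1 \ x.1) ≃ ↥((κ y).1.1 \ (ψ x).1)) := by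
    intro y
    have := ((hfQ y.1).sdiff (t := x.1)).to_subtype
    have := ((hfR (κ y).1).sdiff (t := (ψ x).1)).to_subtype
    refine Finite.card_eq.1 ?_
    change (y.1.1 \ x.1).ncard = ((ψ y.1).1 \ (ψ x).1).ncard
    rw [ncard_sdiff y.2.1 (hfQ x), ncard_sdiff (ψ.monotone y.2.1) (hfR _), ncard, ncard, ncard,
      ncard, hs, hs]
  change Nat.card _ = Nat.card _
  exact (Nat.card_congr ((unionEqSigmaOfDisjoint (pairwise_disjoint_covers Q x)).trans
    ((Equiv.sigmaCongr κ fun y => (hκ y).some).trans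
      (unionEqSigmaOfDisjoint (pairwise_disjoint_covers R (ψ x))).symm))).symm

/-! ### The cyclic flats of a free cone -/

/-- The cone of a nonempty flat, as a cyclic flat of the free `m`-cone. -/
def coneFlat {α : Type*} {m : ℕ} (hm : 1 ≤ m) {M : Matroid α} [M.Finite] [M.Loopless]
    (F : NonemptyFlats M) : CyclicFlats (freeCone m M) :=
  ⟨cone m F.1, (freeCone_isCyclicFlat_iff hm M _).2 (Or.inr ⟨F.1, F.2.1, F.2.2, rfl⟩)⟩

section

variable {α β : Type*} {m n : ℕ} {M : Matroid α} {N : Matroid β} [M.Finite] [N.Finite]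
  [M.Loopless] [N.Loopless]

lemma tip_mem_coneFlat (hm : 1 ≤ m) (F : NonemptyFlats M) : Point.tip ∈ (coneFlat hm F).1 :=
  trivial

lemma coneFlat_le_iff (hm : 1 ≤ m) {F G : NonemptyFlats M} :
    coneFlat hm F ≤ coneFlat hm G ↔ F ≤ G :=
  ⟨fun h e he => h (show Point.base e ∈ cone m F.1 from he), fun h => cone_mono h⟩

lemma coneFlat_injective (hm : 1 ≤ m) :
    Function.Injective (coneFlat hm : NonemptyFlats M → CyclicFlats (freeCone m M)) :=
  fun _ _ h => le_antisymm ((coneFlat_le_iff hm).1 h.le) ((coneFlat_le_iff hm).1 h.ge)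

lemma eRk_coneFlat (hm : 1 ≤ m) (F : NonemptyFlats M) :
    (freeCone m M).eRk (coneFlat hm F).1 = M.eRk F.1 + 1 :=
  freeCone_eRk_cone M F.2.1.subset_ground

lemma exists_coneFlat_eq (hm : 1 ≤ m) {x : CyclicFlats (freeCone m M)} (hx : Point.tip ∈ x.1) :
    ∃ F, x = coneFlat hm F := by
  rcases (freeCone_isCyclicFlat_iff hm M x.1).1 x.2 with ⟨F, -, h⟩ | ⟨F, hF, hne, h⟩
  · rw [h] at hx
    simp at hx
  · exact ⟨⟨F, hF, hne⟩, Subtype.ext h⟩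

lemma exists_base_eq (hm : 1 ≤ m) {x : CyclicFlats (freeCone m M)} (hx : Point.tip ∉ x.1) :
    ∃ F, IsCyclicFlat M F ∧ x.1 = Point.base '' F := by
  rcases (freeCone_isCyclicFlat_iff hm M x.1).1 x.2 with h | ⟨F, hF, hne, h⟩
  · exact h
  · exact absurd (h ▸ trivial) hx

lemma subset_base_ground (hm : 1 ≤ m) {x : CyclicFlats (freeCone m M)} (hx : Point.tip ∉ x.1) :
    x.1 ⊆ Point.base '' M.E := by
  obtain ⟨F, hF, h⟩ := exists_base_eq hm hx
  rw [h]
  exact image_mono hF.1.subset_ground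

lemma coverUnion_coneFlat (hm : 1 ≤ m) (F : NonemptyFlats M) :
    coverUnion (freeCone m M) (coneFlat hm F) = (freeCone m M).E \ (coneFlat hm F).1 := by
  refine (coverUnion_subset _ _).antisymm ?_
  have key : ∀ e ∈ M.E, e ∉ F.1 → ∃ y : CyclicFlats (freeCone m M), coneFlat hm F ≤ y ∧
      (freeCone m M).eRk y.1 = (freeCone m M).eRk (coneFlat hm F).1 + 1 ∧ cone m {e} ⊆ y.1 := by
    intro e he heF
    have hsub : insert e F.1 ⊆ M.closure (insert e F.1) :=
      M.subset_closure _ (insert_subset he F.2.1.subset_ground)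
    refine ⟨coneFlat hm ⟨M.closure (insert e F.1), M.isFlat_closure _, e,
      hsub (mem_insert _ _)⟩, ?_, ?_, ?_⟩
    · exact (coneFlat_le_iff hm).2 ((subset_insert _ _).trans hsub)
    · rw [eRk_coneFlat, eRk_coneFlat, Matroid.eRk_closure_eq, eRk_insert_of_isFlat F.2.1 he heF]
    · exact cone_mono (by simpa using hsub (mem_insert _ _))
  rintro (e | ⟨e, i⟩ | _) ⟨hE, hF⟩
  · obtain ⟨y, h1, h2, h3⟩ := key e hE hF
    exact mem_coverUnion.2 ⟨y, h1, h2, h3 (rfl : e = e), hF⟩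
  · obtain ⟨y, h1, h2, h3⟩ := key e hE hF
    exact mem_coverUnion.2 ⟨y, h1, h2, h3 (rfl : e = e), hF⟩
  · exact absurd trivial hF

lemma eq_base_ground_of_coverUnion_eq (hm : 1 ≤ m) {x : CyclicFlats (freeCone m M)}
    (hx : Point.tip ∉ x.1) (h : coverUnion (freeCone m M) x = (freeCone m M).E \ x.1) :
    x.1 = Point.base '' M.E := by
  refine (subset_base_ground hm hx).antisymm ?_
  rintro _ ⟨e, he, rfl⟩
  obtain ⟨Z, hZ, hxZ⟩ := exists_base_eq hm hx
  have hc : Point.copy e ⟨0, hm⟩ ∈ coverUnion (freeCone m M) x := by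
    rw [h, hxZ]
    exact ⟨he, by simp⟩
  -- the cyclic flats that contain a copy of `e` are cones, and the only cone that covers `Z` is
  -- the cone of `Z`
  obtain ⟨y, hxy, hr, hey, -⟩ := mem_coverUnion.1 hc
  have ht : Point.tip ∈ y.1 := by
    by_contra ht
    have := subset_base_ground hm ht hey
    simp at this
  obtain ⟨F, rfl⟩ := exists_coneFlat_eq hm ht
  have hZF : Z ⊆ F.1 := by
    intro f hf
    exact hxy (show Point.base f ∈ x.1 by rw [hxZ]; exact mem_image_of_mem _ hf)
  rw [eRk_coneFlat, hxZ, freeCone_eRk_base] at hr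
  have hZF' : Z = F.1 := eq_of_isFlat_of_eRk_le hZ.1 F.2.1.subset_ground hZF
    ((ENat.add_le_add_iff_right (by simp)).1 hr.le)
  rw [hxZ, hZF']
  exact mem_image_of_mem _ hey

/-- The top cyclic flat of the free cone of a nonempty matroid. -/
def topCone (hm : 1 ≤ m) (hE : M.E.Nonempty) : CyclicFlats (freeCone m M) :=
  coneFlat hm ⟨M.E, M.ground_isFlat, hE⟩

lemma le_topCone (hm : 1 ≤ m) (hE : M.E.Nonempty) (x : CyclicFlats (freeCone m M)) :
    x ≤ topCone hm hE :=
  x.2.1.subset_ground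

lemma map_topCone (hm : 1 ≤ m) (hn : 1 ≤ n) (hE : M.E.Nonempty) (hE' : N.E.Nonempty)
    (ψ : CyclicFlats (freeCone m M) ≃o CyclicFlats (freeCone n N)) :
    ψ (topCone hm hE) = topCone hn hE' := by
  refine (le_topCone hn hE' _).antisymm ?_
  rw [← ψ.symm_apply_le]
  exact le_topCone hm hE _

/-- A configuration-preserving bijection sends a cone to a cone or to the ground set of the
original matroid: these are the only cyclic flats whose covering cyclic flats can contain all
elements of the free cone, and whether they do can be read off the configuration. -/
lemma map_eq_base_ground (hm : 1 ≤ m) (hn : 1 ≤ n)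
    (ψ : CyclicFlats (freeCone m M) ≃o CyclicFlats (freeCone n N))
    (hs : ∀ x, (ψ x).1.encard = x.1.encard)
    (hr : ∀ x, (freeCone n N).eRk (ψ x).1 = (freeCone m M).eRk x.1)
    (hE' : N.E.Nonempty) {x : CyclicFlats (freeCone m M)} (hx : Point.tip ∈ x.1)
    (hψx : Point.tip ∉ (ψ x).1) : (ψ x).1 = Point.base '' N.E := by
  refine eq_base_ground_of_coverUnion_eq hn hψx ?_
  have hfin : ∀ y : CyclicFlats (freeCone n N), y.1.Finite := fun y =>
    (freeCone n N).ground_finite.subset y.2.1.subset_ground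
  have hfin' : ∀ y : CyclicFlats (freeCone m M), y.1.Finite := fun y =>
    (freeCone m M).ground_finite.subset y.2.1.subset_ground
  refine eq_of_subset_of_ncard_le (coverUnion_subset _ _) ?_ (hfin (topCone hn hE')).sdiff
  obtain ⟨F, rfl⟩ := exists_coneFlat_eq hm hx
  have hE : M.E.Nonempty := F.2.2.mono F.2.1.subset_ground
  rw [ncard_coverUnion_eq ψ hs hr, coverUnion_coneFlat]
  change ((topCone hn hE').1 \ _).ncard ≤ ((topCone hm hE).1 \ _).ncard
  rw [ncard_sdiff (le_topCone hn hE' _) (hfin _), ncard_sdiff (le_topCone hm hE _) (hfin' _),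
    ← map_topCone hm hn hE hE' ψ, ncard, ncard, ncard, ncard, hs, hs]

end

/-! ### From the cyclic flats of the cones to the matroids -/

/-- Two elements of a partial order that are above the same elements and below the same elements are
exchanged by an automorphism that fixes all others. -/
lemma exists_swap {P : Type*} [PartialOrder P] (a b : P) (hlt : ∀ z, z < a ↔ z < b)
    (hgt : ∀ z, a < z ↔ b < z) :
    ∃ σ : P ≃o P, σ a = b ∧ σ b = a ∧ ∀ z, z ≠ a → z ≠ b → σ z = z := by
  classical
  have hmono : ∀ z w, z < w → Equiv.swap a b z < Equiv.swap a b w := by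
    intro z w h
    have h1 := hlt a
    have h2 := hlt b
    have h3 : ∀ c : P, ¬ c < c := lt_irrefl
    rw [Equiv.swap_apply_def, Equiv.swap_apply_def]
    split_ifs <;> grind
  have hmono' : Monotone (Equiv.swap a b) := by
    intro z w h
    rcases h.eq_or_lt with rfl | h
    · exact le_rfl
    · exact (hmono z w h).le
  refine ⟨⟨Equiv.swap a b, @fun z w => ⟨fun h => ?_, fun h => hmono' h⟩⟩, ?_, ?_, ?_⟩
  · simpa using hmono' h
  · exact Equiv.swap_apply_left a b
  · exact Equiv.swap_apply_right a b
  · exact fun z => Equiv.swap_apply_of_ne_of_ne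

section

variable {α β : Type*} {m n : ℕ} {M : Matroid α} {N : Matroid β} [M.Finite] [N.Finite]
  [M.Loopless] [N.Loopless]

/-- An isomorphism of the lattices of cyclic flats that sends cones to cones restricts to an
isomorphism of the posets of nonempty flats. -/
lemma exists_nonemptyFlats_orderIso (hm : 1 ≤ m) (hn : 1 ≤ n)
    (ψ : CyclicFlats (freeCone m M) ≃o CyclicFlats (freeCone n N))
    (hc : ∀ x, Point.tip ∈ (ψ x).1 ↔ Point.tip ∈ x.1) :
    ∃ θ : NonemptyFlats M ≃o NonemptyFlats N, ∀ F, ψ (coneFlat hm F) = coneFlat hn (θ F) := by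
  have h1 : ∀ F : NonemptyFlats M, ∃ G, ψ (coneFlat hm F) = coneFlat hn G := fun F =>
    exists_coneFlat_eq hn ((hc _).2 (tip_mem_coneFlat hm F))
  choose θ hθ using h1
  have hle : ∀ F G, θ F ≤ θ G ↔ F ≤ G := by
    intro F G
    rw [← coneFlat_le_iff hn, ← hθ, ← hθ, ψ.le_iff_le, coneFlat_le_iff]
  have hsurj : Function.Surjective θ := by
    intro G
    have h2 : Point.tip ∈ (ψ.symm (coneFlat hn G)).1 := by
      rw [← hc, ψ.apply_symm_apply]
      exact tip_mem_coneFlat hn G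
    obtain ⟨F, hF⟩ := exists_coneFlat_eq hm h2
    refine ⟨F, coneFlat_injective hn ?_⟩
    rw [← hθ, ← hF, ψ.apply_symm_apply]
  exact ⟨RelIso.ofSurjective (OrderEmbedding.ofMapLEIff θ hle) hsurj, hθ⟩

lemma exists_cyclicFlat_eq_empty (hm : 1 ≤ m) : ∃ o : CyclicFlats (freeCone m M), o.1 = ∅ :=
  ⟨⟨∅, (freeCone_isCyclicFlat_iff hm M _).2 (Or.inl ⟨∅, ⟨isFlat_empty M,
    isCyclic_iff.2 ⟨empty_subset _, fun _ he => he.elim⟩⟩, (image_empty _).symm⟩)⟩, rfl⟩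

/-- A nontrivial parallel class `P` is the only nonempty cyclic flat strictly below its cone, so an
isomorphism that sends the cone of `P` to the cone of `P'` sends `P` to `P'`. -/
lemma map_base_parallelClass (hm : 1 ≤ m) (hn : 1 ≤ n)
    (ψ : CyclicFlats (freeCone m M) ≃o CyclicFlats (freeCone n N))
    (hc : ∀ x, Point.tip ∈ (ψ x).1 ↔ Point.tip ∈ x.1) {P : NonemptyFlats M} {P' : NonemptyFlats N}
    (hP' : IsMin P') (hψ : ψ (coneFlat hm P) = coneFlat hn P') (hPc : IsCyclicFlat M P.1) :
    ∃ x : CyclicFlats (freeCone m M), x.1 = Point.base '' P.1 ∧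
      (ψ x).1 = Point.base '' P'.1 ∧ IsCyclicFlat N P'.1 := by
  let x : CyclicFlats (freeCone m M) :=
    ⟨_, (freeCone_isCyclicFlat_iff hm M _).2 (Or.inl ⟨P.1, hPc, rfl⟩)⟩
  obtain ⟨o, ho⟩ := exists_cyclicFlat_eq_empty (M := M) hm
  have hx : Point.tip ∉ x.1 := by
    change Point.tip ∉ Point.base '' P.1
    simp
  have hox : o ≠ x := by
    intro h
    obtain ⟨e, he⟩ := P.2.2
    have h1 : Point.base e ∈ o.1 := by
      rw [h]
      exact mem_image_of_mem _ he
    rw [ho] at h1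
    exact h1
  have hxP : x ≤ coneFlat hm P := base_image_subset subset_rfl
  obtain ⟨Z, hZ, hZx⟩ := exists_base_eq hn (fun h => hx ((hc x).1 h))
  have hZne : Z.Nonempty := by
    rw [nonempty_iff_ne_empty]
    rintro rfl
    have h1 : (ψ x).1 ⊆ (ψ o).1 := by
      rw [hZx]
      simp
    have h2 : x ≤ o := ψ.le_iff_le.1 h1
    exact hox (le_antisymm (show o.1 ⊆ x.1 from ho ▸ empty_subset _) h2)
  have hZP : Z ⊆ P'.1 := by
    intro e he
    have h1 := ψ.monotone hxP
    rw [hψ] at h1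
    exact h1 (show Point.base e ∈ (ψ x).1 from hZx ▸ mem_image_of_mem _ he)
  have hZP' : Z = P'.1 := hZP.antisymm (@hP' ⟨Z, hZ.1, hZne⟩ hZP)
  exact ⟨x, rfl, hZP' ▸ hZx, hZP' ▸ hZ⟩

/-- The size of a parallel class is the size of the nonempty cyclic flat strictly below its cone,
and one if there is none. Preservation of sizes is only asked for in rank one, as this survives the
exchange made in `isomorphic_of_map_cone_eq_base`. -/
lemma isomorphic_of_map_cones (hm : 1 ≤ m) (hn : 1 ≤ n)
    (ψ : CyclicFlats (freeCone m M) ≃o CyclicFlats (freeCone n N))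
    (hc : ∀ x, Point.tip ∈ (ψ x).1 ↔ Point.tip ∈ x.1)
    (hs : ∀ x, (freeCone m M).eRk x.1 = 1 → (ψ x).1.encard = x.1.encard) : Isomorphic M N := by
  obtain ⟨θ, hθ⟩ := exists_nonemptyFlats_orderIso hm hn ψ hc
  refine isomorphic_of_nonemptyFlats θ fun e => ?_
  have hmin : IsMin (θ (parallelClass M e)) := θ.isMin_apply.2 (isMin_parallelClass e)
  obtain ⟨f, hf⟩ : ∃ f, parallelClass N f = θ (parallelClass M e) := by
    obtain ⟨f, hf⟩ := (θ (parallelClass M e)).2.2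
    exact ⟨⟨f, (θ (parallelClass M e)).2.1.subset_ground hf⟩, (parallelClass_eq_iff hmin).2 hf⟩
  by_cases hP : (parallelClass M e).1.Nontrivial
  · obtain ⟨x, hx, hψx, -⟩ := map_base_parallelClass hm hn ψ hc hmin (hθ _)
      (isCyclicFlat_parallelClass hP)
    have h := hs x (by rw [hx, freeCone_eRk_base, eRk_parallelClass])
    rwa [hx, hψx, base_injective.encard_image, base_injective.encard_image] at h
  · have hP' : ¬ (θ (parallelClass M e)).1.Nontrivial := by
      intro h
      rw [← hf] at h
      have h1 := isCyclicFlat_parallelClass h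
      rw [hf] at h1
      obtain ⟨-, -, -, h2⟩ := map_base_parallelClass hn hm ψ.symm
        (fun x => by rw [← hc, ψ.apply_symm_apply]) (isMin_parallelClass e)
        (by rw [← hθ, ψ.symm_apply_apply]) h1
      exact hP (nontrivial_of_isCyclic h2.2 (parallelClass M e).2.2)
    rw [Set.not_nontrivial_iff] at hP hP'
    obtain ⟨a, ha⟩ := (parallelClass M e).2.2
    obtain ⟨b, hb⟩ := (θ (parallelClass M e)).2.2
    rw [hP.eq_singleton_of_mem ha, hP'.eq_singleton_of_mem hb, encard_singleton, encard_singleton]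

lemma eq_topCone_of_base_ground_lt (hm : 1 ≤ m) (hE : M.E.Nonempty)
    {x y : CyclicFlats (freeCone m M)} (hx : x.1 = Point.base '' M.E) (h : x < y) :
    y = topCone hm hE := by
  have ht : Point.tip ∈ y.1 := by
    by_contra ht
    exact h.not_ge (show y.1 ⊆ x.1 from hx ▸ subset_base_ground hm ht)
  obtain ⟨F, rfl⟩ := exists_coneFlat_eq hm ht
  refine (le_topCone hm hE _).antisymm ((coneFlat_le_iff hm).2 fun e he => ?_)
  exact h.le (show Point.base e ∈ x.1 from hx ▸ mem_image_of_mem _ he)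

/-- Suppose that a configuration-preserving bijection `ψ` sends the cone `x` to the ground set of
`N`. Then `M` has rank two, and `ψ` sends the ground set of `M` to a cone. These two elements are
above the same elements and below the same elements, so exchanging them turns `ψ` into an
isomorphism that sends cones to cones. -/
lemma isomorphic_of_map_cone_eq_base (hm : 1 ≤ m) (hn : 1 ≤ n)
    (ψ : CyclicFlats (freeCone m M) ≃o CyclicFlats (freeCone n N))
    (hs : ∀ x, (ψ x).1.encard = x.1.encard)
    (hr : ∀ x, (freeCone n N).eRk (ψ x).1 = (freeCone m M).eRk x.1)
    (hE : M.E.Nonempty) (hE' : N.E.Nonempty)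
    {x : CyclicFlats (freeCone m M)} (hx : Point.tip ∈ x.1) (hψx : Point.tip ∉ (ψ x).1) :
    Isomorphic M N := by
  have hs' : ∀ y, (ψ.symm y).1.encard = y.1.encard := fun y => by
    rw [← hs, ψ.apply_symm_apply]
  have hr' : ∀ y, (freeCone m M).eRk (ψ.symm y).1 = (freeCone n N).eRk y.1 := fun y => by
    rw [← hr, ψ.apply_symm_apply]
  have hxN := map_eq_base_ground hm hn ψ hs hr hE' hx hψx
  -- `x` is the only cone whose image is not a cone
  have huniq : ∀ z, Point.tip ∈ z.1 → Point.tip ∉ (ψ z).1 → z = x := fun z hz hψz =>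
    ψ.injective (Subtype.ext ((map_eq_base_ground hm hn ψ hs hr hE' hz hψz).trans hxN.symm))
  -- hence no cone lies strictly below `x`, and `x` is the cone of a parallel class
  obtain ⟨e, rfl⟩ : ∃ e : M.E, x = coneFlat hm (parallelClass M e) := by
    obtain ⟨H, rfl⟩ := exists_coneFlat_eq hm hx
    obtain ⟨e, he⟩ := H.2.2
    refine ⟨⟨e, H.2.1.subset_ground he⟩, (huniq _ (tip_mem_coneFlat hm _) fun h => hψx ?_).symm⟩
    exact ψ.monotone ((coneFlat_le_iff hm).2 (parallelClass_le_iff.2 he)) h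
  have hrx : (freeCone m M).eRk (coneFlat hm (parallelClass M e)).1 = 2 := by
    rw [eRk_coneFlat, eRk_parallelClass, one_add_one_eq_two]
  have hrN : N.eRk N.E = 2 := by
    rw [← hrx, ← hr, hxN, freeCone_eRk_base]
  have hrM : M.eRk M.E = 2 := by
    have h := hr (topCone hm hE)
    rw [map_topCone hm hn hE hE', topCone, topCone, eRk_coneFlat, eRk_coneFlat, hrN] at h
    exact le_antisymm ((ENat.add_le_add_iff_right (by simp)).1 h.ge)
      ((ENat.add_le_add_iff_right (by simp)).1 h.le)
  -- the preimage of some cone is not a cone: otherwise, the preimages of two cones of parallel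
  -- classes and `x` are cones of three parallel classes, so the ground set of `M` is cyclic; its
  -- image is then below that of `x`, but the ground set is not contained in a parallel class
  obtain ⟨y, hy, hψy⟩ : ∃ y : CyclicFlats (freeCone n N),
      Point.tip ∈ y.1 ∧ Point.tip ∉ (ψ.symm y).1 := by
    by_contra! hcon
    obtain ⟨f₁, hf₁⟩ := hE'
    obtain ⟨f₂, hf₂, hf₂₁⟩ : ∃ f₂ ∈ N.E, f₂ ∉ (parallelClass N ⟨f₁, hf₁⟩).1 := by
      by_contra! hall
      have h := N.eRk_mono (show N.E ⊆ _ from hall)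
      rw [hrN, eRk_parallelClass] at h
      exact absurd h (by decide)
    have hpre : ∀ f : N.E, ∃ g : M.E,
        ψ (coneFlat hm (parallelClass M g)) = coneFlat hn (parallelClass N f) := by
      intro f
      obtain ⟨F, hF⟩ := exists_coneFlat_eq hm
        (hcon (coneFlat hn (parallelClass N f)) (tip_mem_coneFlat hn _))
      obtain ⟨g, hg⟩ := F.2.2
      have hgF : parallelClass M ⟨g, F.2.1.subset_ground hg⟩ = F := by
        refine Subtype.ext (eq_of_isFlat_of_eRk_le (parallelClass M _).2.1 F.2.1.subset_ground
          (parallelClass_le_iff.2 hg) ?_)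
        have h := hr' (coneFlat hn (parallelClass N f))
        rw [hF, eRk_coneFlat, eRk_coneFlat, eRk_parallelClass] at h
        rw [eRk_parallelClass]
        exact (ENat.add_le_add_iff_right (by simp)).1 h.le
      exact ⟨_, by rw [hgF, ← hF, ψ.apply_symm_apply]⟩
    obtain ⟨g₁, hg₁⟩ := hpre ⟨f₁, hf₁⟩
    obtain ⟨g₂, hg₂⟩ := hpre ⟨f₂, hf₂⟩
    have hne : ∀ g f, ψ (coneFlat hm (parallelClass M g)) = coneFlat hn (parallelClass N f) →
        parallelClass M e ≠ parallelClass M g := by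
      intro g f hgf h
      rw [h, hgf] at hψx
      exact hψx (tip_mem_coneFlat hn _)
    have h₁₂ : parallelClass M g₁ ≠ parallelClass M g₂ := by
      intro h
      rw [h, hg₂] at hg₁
      have h1 := coneFlat_injective hn hg₁
      exact hf₂₁ (parallelClass_le_iff (e := ⟨f₂, hf₂⟩).1 h1.le)
    have hcyc := isCyclicFlat_ground_of_three hrM (hne _ _ hg₁) (hne _ _ hg₂) h₁₂
    let b : CyclicFlats (freeCone m M) :=
      ⟨_, (freeCone_isCyclicFlat_iff hm M _).2 (Or.inl ⟨M.E, hcyc, rfl⟩)⟩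
    have hb : Point.tip ∉ (ψ b).1 := by
      intro h
      have h1 := hcon _ h
      rw [ψ.symm_apply_apply] at h1
      have h2 : (Point.tip : Point α m) ∈ Point.base '' M.E := h1
      simp at h2
    have hbx : b ≤ coneFlat hm (parallelClass M e) := by
      rw [← ψ.le_iff_le]
      exact (subset_base_ground hn hb).trans hxN.ge
    have hEe : M.E ⊆ (parallelClass M e).1 := fun g hg =>
      hbx (show Point.base g ∈ b.1 from mem_image_of_mem _ hg)
    have h := M.eRk_mono hEe
    rw [hrM, eRk_parallelClass] at h
    exact absurd h (by decide)
  have hyM := map_eq_base_ground hn hm ψ.symm hs' hr' hE hy hψy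
  obtain ⟨b, rfl⟩ := ψ.surjective y
  rw [ψ.symm_apply_apply] at hyM hψy
  have huniq' : ∀ z, Point.tip ∉ z.1 → Point.tip ∈ (ψ z).1 → z = b := fun z hz hψz => by
    have h := map_eq_base_ground hn hm ψ.symm hs' hr' hE hψz (by rwa [ψ.symm_apply_apply])
    rw [ψ.symm_apply_apply] at h
    exact Subtype.ext (h.trans hyM.symm)
  set x := coneFlat hm (parallelClass M e)
  have hlt : ∀ z, z < x ↔ z < b := by
    intro z
    constructor
    · intro h
      have h1 : Point.tip ∉ (ψ z).1 := fun ht => hψx (ψ.monotone h.le ht)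
      have h2 : Point.tip ∉ z.1 := fun ht => h.ne (huniq z ht h1)
      refine lt_of_le_of_ne ((subset_base_ground hm h2).trans hyM.ge) ?_
      rintro rfl
      exact h1 hy
    · intro h
      have h1 : Point.tip ∉ z.1 := fun ht => hψy (h.le ht)
      have h2 : Point.tip ∉ (ψ z).1 := fun ht => h.ne (huniq' z h1 ht)
      refine lt_of_le_of_ne (ψ.le_iff_le.1 ((subset_base_ground hn h2).trans hxN.ge)) ?_
      rintro rfl
      exact h1 hx
  have hgt : ∀ z, x < z ↔ b < z := by
    intro z
    constructor
    · intro h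
      have h1 := eq_topCone_of_base_ground_lt hn hE' hxN (ψ.lt_iff_lt.2 h)
      rw [← map_topCone hm hn hE hE' ψ] at h1
      rw [ψ.injective h1] at h ⊢
      refine lt_of_le_of_ne (le_topCone hm hE b) ?_
      rintro rfl
      exact hψy (tip_mem_coneFlat hm _)
    · intro h
      obtain rfl := eq_topCone_of_base_ground_lt hm hE hyM h
      refine lt_of_le_of_ne (le_topCone hm hE x) fun hxt => ?_
      rw [← hxt, hlt] at h
      exact lt_irrefl b h
  obtain ⟨σ, hσx, hσb, hσ⟩ := exists_swap x b hlt hgt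
  refine isomorphic_of_map_cones hm hn (σ.trans ψ) (fun z => ?_) fun z hz => ?_
  · change Point.tip ∈ (ψ (σ z)).1 ↔ _
    by_cases hzx : z = x
    · rw [hzx, hσx]
      exact iff_of_true hy hx
    · by_cases hzb : z = b
      · rw [hzb, hσb]
        exact iff_of_false hψx hψy
      · rw [hσ z hzx hzb]
        exact ⟨fun h => by_contra fun h' => hzb (huniq' z h' h),
          fun h => by_contra fun h' => hzx (huniq z h h')⟩
  · have hzx : z ≠ x := by
      rintro rfl
      rw [hrx] at hz
      exact absurd hz (by decide)
    have hzb : z ≠ b := by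
      rintro rfl
      rw [hyM, freeCone_eRk_base, hrM] at hz
      exact absurd hz (by decide)
    change (ψ (σ z)).1.encard = _
    rw [hσ z hzx hzb, hs]

lemma isomorphic_of_ground_eq_empty (hm : 1 ≤ m) (hn : 1 ≤ n)
    (ψ : CyclicFlats (freeCone m M) ≃o CyclicFlats (freeCone n N)) (hE : M.E = ∅) :
    Isomorphic M N := by
  have hno : ∀ x : CyclicFlats (freeCone m M), x.1 = ∅ := by
    intro x
    rcases (freeCone_isCyclicFlat_iff hm M x.1).1 x.2 with ⟨F, hF, h⟩ | ⟨F, hF, hne, -⟩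
    · have hF' := hF.1.subset_ground
      rw [hE, subset_empty_iff] at hF'
      rw [h, hF', image_empty]
    · exact absurd (hne.mono hF.subset_ground) (by simp [hE])
  have hE' : N.E = ∅ := by
    by_contra hne
    rw [← Ne, ← nonempty_iff_ne_empty] at hne
    obtain ⟨o, ho⟩ := exists_cyclicFlat_eq_empty (M := N) hn
    have h1 : topCone hn hne = o := by
      apply ψ.symm.injective
      exact Subtype.ext ((hno _).trans (hno _).symm)
    have h2 : Point.tip ∈ o.1 := h1 ▸ tip_mem_coneFlat hn _
    rw [ho] at h2
    exact h2
  have := isEmpty_coe_sort.2 hE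
  have := isEmpty_coe_sort.2 hE'
  refine ⟨Equiv.equivOfIsEmpty _ _, fun I => ?_⟩
  rw [eq_empty_of_isEmpty I]
  simp

end

end FreeCone

/-- The configuration of the free cone of a finite loopless matroid determines the matroid up to
isomorphism. -/
theorem theorem3p7 {α β : Type*} (M : Matroid α) (N : Matroid β) [M.Finite] [N.Finite]
    [M.Loopless] [N.Loopless] (m n : ℕ) (hm : 1 ≤ m) (hn : 1 ≤ n)
    {L : Type*} [Lattice L] (s ρ : L → ℕ)
    (hM : FreeCone.IsConfiguration (FreeCone.freeCone m M) s ρ)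
    (hN : FreeCone.IsConfiguration (FreeCone.freeCone n N) s ρ) :
    FreeCone.Isomorphic M N := by
  obtain ⟨φ, hφ⟩ := hM
  obtain ⟨φ', hφ'⟩ := hN
  let ψ := φ.symm.trans φ'
  have hs : ∀ x, (ψ x).1.encard = x.1.encard := fun x => by
    have h := (hφ (φ.symm x)).1
    rw [φ.apply_symm_apply] at h
    exact (hφ' (φ.symm x)).1.symm.trans h
  have hr : ∀ x, (FreeCone.freeCone n N).eRk (ψ x).1 = (FreeCone.freeCone m M).eRk x.1 :=
      fun x => by
    have h := (hφ (φ.symm x)).2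
    rw [φ.apply_symm_apply] at h
    exact (hφ' (φ.symm x)).2.symm.trans h
  rcases M.E.eq_empty_or_nonempty with hE | hE
  · exact FreeCone.isomorphic_of_ground_eq_empty hm hn ψ hE
  rcases N.E.eq_empty_or_nonempty with hE' | hE'
  · exact (FreeCone.isomorphic_of_ground_eq_empty hn hm ψ.symm hE').symm
  by_cases h₁ : ∃ x, FreeCone.Point.tip ∈ x.1 ∧ FreeCone.Point.tip ∉ (ψ x).1
  · obtain ⟨x, hx, hψx⟩ := h₁
    exact FreeCone.isomorphic_of_map_cone_eq_base hm hn ψ hs hr hE hE' hx hψx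
  by_cases h₂ : ∃ x, FreeCone.Point.tip ∉ x.1 ∧ FreeCone.Point.tip ∈ (ψ x).1
  · obtain ⟨x, hx, hψx⟩ := h₂
    refine (FreeCone.isomorphic_of_map_cone_eq_base hn hm ψ.symm (fun y => ?_) (fun y => ?_) hE' hE
      hψx (by rwa [ψ.symm_apply_apply])).symm
    · rw [← hs, ψ.apply_symm_apply]
    · rw [← hr, ψ.apply_symm_apply]
  push Not at h₁ h₂
  exact FreeCone.isomorphic_of_map_cones hm hn ψ
    (fun x => ⟨fun h => by_contra fun h' => h₂ x h' h, h₁ x⟩) fun x _ => hs x
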